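/- Let $\mathrm{PU}_3=\mathrm U_3/Z(\mathrm U_3)$ be the projective unitary group, let $w=e^{2\pi i/3}$, and let $K\le \mathrm{PU}_3$ be the subgroup generated by the classes of $$A=\begin{pmatrix}0&0&1\\1&0&0\\0&1&0\end{pmatrix},\qquad B=\begin{pmatrix}1&0&0\\0&w&0\\0&0&w^2\end{pmatrix}.$$ The \emph{Schwarz genus} of a covering $E\to X$ is the least $k$ such that $X$ can be covered by $k$ open subsets over each of which the covering has a continuous section. Then the projection $\mathrm{PU}_3\to \mathrm{PU}_3/K$, $g\mapsto gK$, is a covering and has Schwarz genus at most $8$. Moreover, let $H=\{\mathrm{diag}(1,z,z) : z\in \mathrm U_1\}\le \mathrm{PU}_3$. Then: (i) $H\cap gKg^{-1}=1$ for every $g\in \mathrm{PU}_3$; (ii) the action of $K$ by right multiplication on the coset space $H\backslash \mathrm{PU}_3$ is free; (iii) the double coset space $H\backslash \mathrm{PU}_3/K$ is a (topological) manifold of dimension $7$; (iv) $H\backslash \mathrm{PU}_3\to H\backslash \mathrm{PU}_3/K$ is a covering, and the covering $\mathrm{PU}_3\to \mathrm{PU}_3/K$ is its pullback along the map $\mathrm{PU}_3/K\to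 H\backslash \mathrm{PU}_3/K$, $gK\mapsto HgK$; that is, $g\mapsto (gK,Hg)$ is a homeomorphism from $\mathrm{PU}_3$ onto the fibre product of $\mathrm{PU}_3/K$ and $H\backslash \mathrm{PU}_3$ over $H\backslash \mathrm{PU}_3/K$. -/

import Mathlib

/-- `p` has local continuous sections over the members of some open cover of its base by
`k` sets. -/
def HasSectionCover {E B : Type*} [TopologicalSpace E] [TopologicalSpace B]
    (p : E → B) (k : ℕ) : Prop :=
  ∃ U : Fin k → Set B, (∀ i, IsOpen (U i)) ∧ (⋃ i, U i) = Set.univ ∧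
    ∀ i, ∃ s : U i → E, Continuous s ∧ ∀ b : U i, p (s b) = b

/-- The Schwarz genus of a map: the least `k` such that the base is covered by `k` open sets
over each of which the map has a continuous section (and `⊤` if there is no such `k`). -/
noncomputable def schwarzGenus {E B : Type*} [TopologicalSpace E] [TopologicalSpace B]
    (p : E → B) : ℕ∞ :=
  ⨅ (k : ℕ) (_ : HasSectionCover p k), (k : ℕ∞)

/-- A topological manifold of dimension `n` (without boundary): Hausdorff, second countable and
locally homeomorphic to Euclidean `n`-space. -/
def IsTopologicalManifold (n : ℕ) (X : Type*) [TopologicalSpace X] : Prop :=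
  T2Space X ∧ SecondCountableTopology X ∧
    Nonempty (ChartedSpace (EuclideanSpace ℝ (Fin n)) X)

/-- The projective unitary group `PU₃ = U₃ / Z(U₃)`, with the quotient topology. -/
abbrev PU3 : Type :=
  Matrix.unitaryGroup (Fin 3) ℂ ⧸ Subgroup.center (Matrix.unitaryGroup (Fin 3) ℂ)

/-- The primitive cube root of unity `e^{2πi/3}`. -/
noncomputable def cubeRoot : ℂ := Complex.exp (2 * Real.pi * Complex.I / 3)

theorem star_cubeRoot_mul_cubeRoot : star cubeRoot * cubeRoot = 1 := by
  have h : (2 * Real.pi * Complex.I / 3 : ℂ) = ((2 * Real.pi / 3 : ℝ) : ℂ) * Complex.I := by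
    push_cast; ring
  rw [cubeRoot, h, Complex.star_def, ← Complex.normSq_eq_conj_mul_self,
    Complex.normSq_eq_norm_sq, Complex.norm_exp_ofReal_mul_I]
  simp

/-- A diagonal matrix with entries of modulus one is unitary. -/
theorem diagonal_mem_unitaryGroup (d : Fin 3 → ℂ) (hd : ∀ i, star (d i) * d i = 1) :
    Matrix.diagonal d ∈ Matrix.unitaryGroup (Fin 3) ℂ := by
  rw [Matrix.mem_unitaryGroup_iff', Matrix.star_eq_conjTranspose, Matrix.diagonal_conjTranspose,
    Matrix.diagonal_mul_diagonal, ← Matrix.diagonal_one]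
  congr 1
  funext i
  exact hd i

/-- The cyclic permutation matrix `A`. -/
def unitaryA : Matrix.unitaryGroup (Fin 3) ℂ :=
  ⟨!![0, 0, 1; 1, 0, 0; 0, 1, 0], by
    rw [Matrix.mem_unitaryGroup_iff']
    ext i j
    fin_cases i <;> fin_cases j <;> simp [Matrix.mul_apply, Fin.sum_univ_three]⟩

/-- The diagonal matrix `B = diag(1, w, w²)` with `w = e^{2πi/3}`. -/
noncomputable def unitaryB : Matrix.unitaryGroup (Fin 3) ℂ :=
  ⟨Matrix.diagonal ![1, cubeRoot, cubeRoot ^ 2], diagonal_mem_unitaryGroup _ (by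
    intro i
    have h := star_cubeRoot_mul_cubeRoot
    fin_cases i
    · simp
    · exact h
    · change star (cubeRoot ^ 2) * cubeRoot ^ 2 = 1
      rw [star_pow, ← mul_pow, h, one_pow])⟩

/-- The unitary matrix `diag(1, z, z)` for `z` on the unit circle. -/
noncomputable def unitaryDiag (z : Circle) : Matrix.unitaryGroup (Fin 3) ℂ :=
  ⟨Matrix.diagonal ![1, (z : ℂ), (z : ℂ)], diagonal_mem_unitaryGroup _ (by
    have h : star (z : ℂ) * (z : ℂ) = 1 := by
      rw [Complex.star_def, ← Complex.normSq_eq_conj_mul_self, Circle.normSq_coe,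
        Complex.ofReal_one]
    intro i
    fin_cases i
    · simp
    · exact h
    · exact h)⟩

/-- `K = ⟨A, B⟩ ≤ PU₃`. -/
noncomputable def subgroupK : Subgroup PU3 :=
  Subgroup.closure {QuotientGroup.mk unitaryA, QuotientGroup.mk unitaryB}

/-- The homomorphism `z ↦ diag(1, z, z)` from the circle group to `U₃`. -/
noncomputable def unitaryDiagHom : Circle →* Matrix.unitaryGroup (Fin 3) ℂ where
  toFun := unitaryDiag
  map_one' := by
    ext i j
    fin_cases i <;> fin_cases j <;> simp [unitaryDiag]
  map_mul' a b := by
    ext i j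
    fin_cases i <;> fin_cases j <;> simp [unitaryDiag]

/-- `H = {diag(1, z, z) : z ∈ U₁} ≤ PU₃`. -/
noncomputable def subgroupH : Subgroup PU3 :=
  ((QuotientGroup.mk' _).comp unitaryDiagHom).range

/-- The space `H \ PU₃` of cosets `Hg`, with the quotient topology. -/
abbrev HCosets : Type := Quotient (MulAction.orbitRel subgroupH PU3)

/-- The right action of `K` on `H \ PU₃`, `(Hg) · k = H(gk)`, as an action of the subgroup `K.op`
of the opposite group. -/
noncomputable instance rightActionHCosets : MulAction subgroupK.op HCosets where
  smul k := Quotient.map (fun g : PU3 => g * k.1.unop) (by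
    rintro _ b ⟨h, rfl⟩
    exact ⟨h, (mul_assoc (h : PU3) b k.1.unop).symm⟩)
  one_smul := by
    rintro ⟨g⟩
    exact congrArg (Quotient.mk _) (mul_one g)
  mul_smul := by
    rintro k l ⟨g⟩
    exact congrArg (Quotient.mk _) (mul_assoc g l.1.unop k.1.unop).symm

/-- The double coset space `H \ PU₃ / K`, with the quotient topology. -/
abbrev DoubleCosets : Type := Quotient (MulAction.orbitRel subgroupK.op HCosets)

/-- The projection `PU₃ → PU₃ / K`, `g ↦ gK`. -/
noncomputable def projK : PU3 → PU3 ⧸ subgroupK := QuotientGroup.mk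

/-- The projection `PU₃ → H \ PU₃`, `g ↦ Hg`. -/
noncomputable def projH : PU3 → HCosets := Quotient.mk _

/-- The projection `H \ PU₃ → H \ PU₃ / K`, `Hg ↦ HgK`. -/
noncomputable def projDouble : HCosets → DoubleCosets := Quotient.mk _

/-- The map `PU₃ / K → H \ PU₃ / K`, `gK ↦ HgK`. -/
noncomputable def baseMap : PU3 ⧸ subgroupK → DoubleCosets :=
  Quotient.lift (fun g : PU3 => projDouble (projH g)) (by
    intro a b hab
    have hk : a⁻¹ * b ∈ subgroupK := QuotientGroup.leftRel_apply.mp hab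
    refine (Quotient.sound ?_ : projDouble (projH a) = projDouble (projH b))
    refine MulAction.orbitRel_apply.mpr ⟨⟨MulOpposite.op (a⁻¹ * b)⁻¹, inv_mem hk⟩, ?_⟩
    change projH (b * (a⁻¹ * b)⁻¹) = projH a
    congr 1
    group)

theorem baseMap_projK (g : PU3) : baseMap (projK g) = projDouble (projH g) := rfl

/-- The comparison map from `PU₃` to the fibre product of `PU₃ / K` and `H \ PU₃` over
`H \ PU₃ / K`. -/
noncomputable def toPullback (g : PU3) : Function.Pullback baseMap projDouble :=
  ⟨(projK g, projH g), baseMap_projK g⟩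

/-! The bound is `8 = 7 + 1`, where `7` is the dimension of `H \ PU₃`. Every nontrivial element of
`K` is represented by a matrix of trace `0`, whereas a scalar multiple of `diag(1, z, z)` has trace
`c (1 + 2z)`, which is nonzero because `|2z| = 2`. Hence no conjugate of a nontrivial element of `K`
lies in `H` (`eq_one_of_conj_mem_subgroupH`). Freeness on `H \ PU₃`, both covering statements and
the bijectivity of the pullback comparison rest on this or on the finiteness of `K`.

For the genus, `HCosets.invariants` embeds `H \ PU₃` in a vector space on which `K` acts through
linear maps. The charts built from `paramU3` show that the image is a finite union of `C¹` images of
`ℝ⁷`, so its Hausdorff dimension is at most `7` and its `8`-dimensional measure vanishes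
(`dimH_range_invariants`). By `exists_open_disjoint_translates_of_hausdorffMeasure_eq_zero`, eight
open sets, each disjoint from its nontrivial translates, have translates covering `PU₃`; their
images in `PU₃ / K` carry sections. That lemma is an induction on dimension: small balls take care
of all points off their bounding spheres, and by Eilenberg's inequality the radii can be chosen so
that the spheres cut the image in a null set of one dimension less.

The same charts make the double coset space a `7`-manifold. -/

/-! ### Hausdorff measure and free actions of finite groups -/

open MeasureTheory Filter Topology Metric in
/-- The null case of Eilenberg's inequality: almost all levels of a `1`-Lipschitz function on a
set of vanishing `(n + 1)`-dimensional Hausdorff measure have vanishing `n`-dimensional measure. -/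
theorem ae_hausdorffMeasure_inter_level_eq_zero {X : Type*} [MetricSpace X] [MeasurableSpace X]
    [BorelSpace X] {f : X → ℝ} (hf : LipschitzWith 1 f) {S : Set X} {n : ℕ}
    (hS : Measure.hausdorffMeasure ((n + 1 : ℕ) : ℝ) S = 0) :
    ∀ᵐ c : ℝ, Measure.hausdorffMeasure (n : ℝ) (S ∩ f ⁻¹' {c}) = 0 := by
  let ε : ℕ → ENNReal := fun m => ((m + 1 : ℕ) : ENNReal)⁻¹
  have hε0 : ∀ m, 0 < ε m := fun m => ENNReal.inv_pos.mpr (ENNReal.natCast_ne_top _)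
  have hε : Tendsto ε atTop (𝓝 0) :=
    (tendsto_add_atTop_iff_nat 1).mpr ENNReal.tendsto_inv_nat_nhds_zero
  have hcov : ∀ m, ∃ t : ℕ → Set X, S ⊆ ⋃ i, t i ∧ (∀ i, ediam (t i) ≤ ε m) ∧
      ∑' i, ediam (t i) ^ ((n + 1 : ℕ) : ℝ) < ε m := by
    intro m
    rw [Measure.hausdorffMeasure_apply] at hS
    have h1 := le_antisymm ((le_iSup₂ (f := fun (r : ENNReal) (_ : 0 < r) =>
        ⨅ (t : ℕ → Set X) (_ : S ⊆ ⋃ n, t n) (_ : ∀ n, ediam (t n) ≤ r),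
          ∑' k, ⨆ _ : (t k).Nonempty, ediam (t k) ^ ((n + 1 : ℕ) : ℝ)) (ε m) (hε0 m)).trans hS.le)
      zero_le
    have h2 := h1.trans_lt (hε0 m)
    simp only [iInf_lt_iff] at h2
    obtain ⟨t, ht, htd, hlt⟩ := h2
    refine ⟨t, ht, htd, lt_of_le_of_lt (ENNReal.tsum_le_tsum fun i => ?_) hlt⟩
    -- The exponent `n + 1` is positive, so empty members contribute `0` and the nonemptiness
    -- condition can be dropped.
    rcases (t i).eq_empty_or_nonempty with h | h
    · rw [h, ediam_empty, ENNReal.zero_rpow_of_pos (by positivity)]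
      exact zero_le
    · exact le_iSup (fun _ : (t i).Nonempty => ediam (t i) ^ ((n + 1 : ℕ) : ℝ)) h
  choose t hSt htd hts using hcov
  -- `g m c` is the sum for the induced cover of the slice at level `c`. Closures make it
  -- measurable, and for `n = 0`, where `0 ^ 0 = 1`, empty members are still not counted.
  let g : ℕ → ℝ → ENNReal := fun m c =>
    ∑' i, (closure (f '' t m i)).indicator (fun _ => ediam (t m i) ^ (n : ℝ)) c
  have hgm : ∀ m, Measurable (g m) := fun m => Measurable.tsum fun i =>
    measurable_const.indicator isClosed_closure.measurableSet
  have hgi : ∀ m, ∫⁻ c, g m c ≤ ε m := by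
    intro m
    rw [lintegral_tsum fun i =>
      (measurable_const.indicator isClosed_closure.measurableSet).aemeasurable]
    refine (ENNReal.tsum_le_tsum fun i => ?_).trans (hts m).le
    rw [lintegral_indicator_const isClosed_closure.measurableSet]
    have h1 : volume (closure (f '' t m i)) ≤ ediam (t m i) := by
      refine (Real.volume_le_diam _).trans ?_
      rw [ediam_closure]
      simpa using hf.ediam_image_le (t m i)
    calc _ ≤ ediam (t m i) ^ (n : ℝ) * ediam (t m i) := by gcongr
      _ = _ := by
        rw [ENNReal.rpow_natCast, ENNReal.rpow_natCast, pow_succ]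
  -- Fatou's lemma.
  have hlim : ∫⁻ c, liminf (fun m => g m c) atTop = 0 := by
    refine le_antisymm ((lintegral_liminf_le hgm).trans ?_) zero_le
    calc _ ≤ liminf ε atTop := liminf_le_liminf (Eventually.of_forall hgi)
      _ = 0 := hε.liminf_eq
  rw [lintegral_eq_zero_iff (Measurable.liminf hgm)] at hlim
  filter_upwards [hlim] with c hc
  refine le_antisymm ?_ zero_le
  have h := Measure.hausdorffMeasure_le_liminf_tsum (n : ℝ) (S ∩ f ⁻¹' {c}) (l := atTop) ε hε
    (ι := fun m => {i // c ∈ closure (f '' t m i)}) (fun m i => t m i.1)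
    (Eventually.of_forall fun m i => htd m i.1) (Eventually.of_forall fun m x hx => by
      obtain ⟨i, hi⟩ := Set.mem_iUnion.mp (hSt m hx.1)
      exact Set.mem_iUnion.mpr ⟨⟨i, subset_closure ⟨x, hi, hx.2⟩⟩, hi⟩)
  refine h.trans (le_of_eq (Eq.trans ?_ hc))
  congr 1
  funext m
  exact tsum_subtype {i | c ∈ closure (f '' t m i)} fun i => ediam (t m i) ^ (n : ℝ)

open MeasureTheory Filter Topology Metric in
/-- If a finite group acts freely on a compact space, and the image of a closed invariant set under
an equivariant map to a metric space has vanishing `n`-dimensional Hausdorff measure, then the set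
is covered by the translates of `n` open sets each of which is disjoint from its own translates. -/
theorem exists_open_disjoint_translates_of_hausdorffMeasure_eq_zero {G X E : Type*} [Group G]
    [Finite G] [TopologicalSpace X] [CompactSpace X] [MulAction G X] [ContinuousConstSMul G X]
    [MetricSpace E] [MeasurableSpace E] [BorelSpace E] {F : X → E} (hF : Continuous F)
    {L : G → E → E} (hL : ∀ g, ∃ C, LipschitzWith C (L g)) (hFL : ∀ (g : G) x, F (g • x) = L g (F x))
    (hfree : ∀ (g : G) x, F (g • x) = F x → g = 1) (n : ℕ) :
    ∀ S : Set X, IsClosed S → (∀ (g : G), ∀ x ∈ S, g • x ∈ S) →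
      Measure.hausdorffMeasure (n : ℝ) (F '' S) = 0 →
      ∃ V : Fin n → Set X, (∀ i, IsOpen (V i)) ∧
        (∀ i (g : G), ∀ x ∈ V i, g • x ∈ V i → g = 1) ∧ ∀ x ∈ S, ∃ i, ∃ g : G, g • x ∈ V i := by
  induction n with
  | zero =>
    intro S _ _ h
    refine ⟨fun _ => ∅, fun _ => isOpen_empty, fun i => i.elim0, fun x hx => ?_⟩
    -- Zero-dimensional measure counts points, so `S` is empty and no open sets are needed.
    have h1 := measure_mono_null (Set.singleton_subset_iff.mpr (Set.mem_image_of_mem F hx)) h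
    rw [Nat.cast_zero, Measure.hausdorffMeasure_zero_singleton] at h1
    exact absurd h1 one_ne_zero
  | succ n ih =>
    intro S hSc hSi hS
    have hrad : ∀ p ∈ Set.range F, ∃ r : ℝ, 0 < r ∧
        Measure.hausdorffMeasure (n : ℝ) (F '' S ∩ sphere p r) = 0 ∧
        ∀ (g : G) y, F y ∈ ball p r → F (g • y) ∈ ball p r → g = 1 := by
      rintro _ ⟨x, rfl⟩
      have h1 : ∀ g : G, ∃ δ > 0, ∀ r ≤ δ, ∀ y, F y ∈ ball (F x) r → F (g • y) ∈ ball (F x) r →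
          g = 1 := by
        intro g
        by_cases hg : g = 1
        · exact ⟨1, one_pos, fun _ _ _ _ _ => hg⟩
        obtain ⟨C, hC⟩ := hL g
        have hd : 0 < dist (L g (F x)) (F x) :=
          dist_pos.mpr fun h => hg (hfree g x ((hFL g x).trans h))
        have hev : ∀ᶠ z in 𝓝 (F x), dist (L g (F x)) (F x) / 2 < dist (L g z) (F x) :=
          (hC.continuous.dist continuous_const).continuousAt.eventually
            (lt_mem_nhds (half_lt_self hd))
        obtain ⟨δ, hδ, hb⟩ := Metric.eventually_nhds_iff_ball.mp hev
        refine ⟨min δ (dist (L g (F x)) (F x) / 2), lt_min hδ (half_pos hd),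
          fun r hr y hy hgy => ?_⟩
        have h2 := hb _ (ball_subset_ball (hr.trans (min_le_left _ _)) hy)
        rw [mem_ball, hFL] at hgy
        exact absurd (hgy.trans_le (hr.trans (min_le_right _ _))) h2.not_gt
      choose δ hδ hδr using h1
      obtain ⟨η, hη, hηδ⟩ : ∃ η > 0, ∀ g, η ≤ δ g := by
        obtain ⟨g₀, h0⟩ := Finite.exists_min δ
        exact ⟨δ g₀, hδ g₀, h0⟩
      have hae := ae_hausdorffMeasure_inter_level_eq_zero (LipschitzWith.dist_left (F x)) hS
      -- Almost every radius is good, and the interval of admissible radii has positive length.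
      obtain ⟨r, hr, hr0⟩ : ∃ r ∈ Set.Ioo 0 η, Measure.hausdorffMeasure (n : ℝ)
          (F '' S ∩ (fun z => dist z (F x)) ⁻¹' {r}) = 0 := by
        by_contra! hcon
        have := measure_mono_null (μ := volume) (fun r hr => hcon r hr) hae
        rw [Real.volume_Ioo, ENNReal.ofReal_eq_zero] at this
        linarith
      exact ⟨r, hr.1, hr0, fun g y => hδr g r (hr.2.le.trans (hηδ g)) y⟩
    choose! r hr0 hrn hrd using hrad
    have hr0' : ∀ x, 0 < r (F x) := fun x => hr0 _ ⟨x, rfl⟩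
    obtain ⟨s, -, hs⟩ := hSc.isCompact.elim_nhds_subcover (fun x => F ⁻¹' ball (F x) (r (F x)))
      fun x _ => hF.continuousAt (ball_mem_nhds _ (hr0' x))
    let e := s.equivFin.symm
    let p : Fin s.card → E := fun i => F (e i)
    -- The exceptional points, some translate of which lands on a bounding sphere, are left to the
    -- induction hypothesis. Their image is null because it lies in finitely many Lipschitz images
    -- of null slices.
    let S' : Set X := S ∩ ⋃ (i : Fin s.card) (g : G), {x | F (g • x) ∈ sphere (p i) (r (p i))}
    have hS'c : IsClosed S' := hSc.inter <| isClosed_iUnion_of_finite fun i =>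
      isClosed_iUnion_of_finite fun g =>
        isClosed_sphere.preimage (hF.comp (continuous_const_smul g))
    have hS'i : ∀ (g : G), ∀ x ∈ S', g • x ∈ S' := by
      rintro g x ⟨hx, hx'⟩
      simp only [Set.mem_iUnion, Set.mem_ofPred_eq] at hx'
      obtain ⟨i, k, hk⟩ := hx'
      refine ⟨hSi g x hx, Set.mem_iUnion₂.mpr ⟨i, k * g⁻¹, ?_⟩⟩
      simpa [mul_smul] using hk
    have hS'0 : Measure.hausdorffMeasure (n : ℝ) (F '' S') = 0 := by
      refine measure_mono_null (t := ⋃ (i : Fin s.card) (g : G),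
        L g⁻¹ '' (F '' S ∩ sphere (p i) (r (p i)))) ?_ ?_
      · rintro _ ⟨x, ⟨hx, hx'⟩, rfl⟩
        simp only [Set.mem_iUnion, Set.mem_ofPred_eq] at hx'
        obtain ⟨i, g, hg⟩ := hx'
        refine Set.mem_iUnion₂.mpr ⟨i, g, F (g • x), ⟨⟨_, hSi g x hx, rfl⟩, hg⟩, ?_⟩
        rw [← hFL, inv_smul_smul]
      · refine measure_iUnion_null fun i => measure_iUnion_null fun g => ?_
        obtain ⟨C, hC⟩ := hL g⁻¹
        refine le_antisymm ((hC.hausdorffMeasure_image_le n.cast_nonneg _).trans ?_) zero_le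
        rw [hrn (p i) ⟨_, rfl⟩, mul_zero]
    obtain ⟨V, hVo, hVd, hVc⟩ := ih S' hS'c hS'i hS'0
    -- Removing all translates of earlier closed balls keeps `W` open and prevents pieces with
    -- different indices from meeting after translation.
    let W : Set X := ⋃ i : Fin s.card, {x | F x ∈ ball (p i) (r (p i))} ∩
      ⋂ (j : Fin s.card) (_ : j < i) (g : G), {x | F (g • x) ∈ closedBall (p j) (r (p j))}ᶜ
    have hWo : IsOpen W := isOpen_iUnion fun i => (isOpen_ball.preimage hF).inter <|
      isOpen_iInter_of_finite fun j => isOpen_iInter_of_finite fun _ =>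
        isOpen_iInter_of_finite fun g =>
          (isClosed_closedBall.preimage (hF.comp (continuous_const_smul g))).isOpen_compl
    have hW : ∀ x, x ∈ W ↔ ∃ i, F x ∈ ball (p i) (r (p i)) ∧
        ∀ j < i, ∀ g : G, F (g • x) ∉ closedBall (p j) (r (p j)) := by
      intro x
      simp [W]
    have hWd : ∀ (g : G), ∀ x ∈ W, g • x ∈ W → g = 1 := by
      intro g x hx hgx
      obtain ⟨i, hi, hi'⟩ := (hW x).mp hx
      obtain ⟨j, hj, hj'⟩ := (hW _).mp hgx
      rcases lt_trichotomy i j with h | rfl | h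
      · refine absurd (ball_subset_closedBall hi) ?_
        simpa using hj' i h g⁻¹
      · exact hrd (p i) ⟨_, rfl⟩ g x hi hj
      · exact absurd (ball_subset_closedBall hj) (hi' j h g)
    refine ⟨Fin.cons W V, fun i => Fin.cases hWo hVo i, fun i => Fin.cases hWd hVd i,
      fun x hx => ?_⟩
    by_cases hx' : x ∈ S'
    · obtain ⟨i, g, h⟩ := hVc x hx'
      exact ⟨i.succ, g, h⟩
    · refine ⟨0, ?_⟩
      have hex : ∃ i : Fin s.card, ∃ g : G, F (g • x) ∈ ball (p i) (r (p i)) := by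
        obtain ⟨y, hy, hxy⟩ := Set.mem_iUnion₂.mp (hs hx)
        refine ⟨s.equivFin ⟨y, hy⟩, 1, ?_⟩
        simpa [p, e] using hxy
      classical
      -- Take the first ball met by the orbit. A translate in an earlier closed ball would lie in
      -- its interior, against minimality, or on its sphere, against `x ∉ S'`.
      obtain ⟨i, ⟨g, hg⟩, hmin⟩ := WellFounded.has_min (wellFounded_lt (α := Fin s.card))
        {i | ∃ g : G, F (g • x) ∈ ball (p i) (r (p i))} hex
      refine ⟨g, (hW _).mpr ⟨i, hg, fun j hj k hk => ?_⟩⟩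
      rw [← mul_smul] at hk
      rcases (mem_closedBall.mp hk).lt_or_eq with h | h
      · exact hmin j ⟨_, h⟩ hj
      · exact hx' ⟨hx, Set.mem_iUnion₂.mpr ⟨j, _, h⟩⟩

/-! ### Sections and charts from local injectivity -/

open Topology in
/-- An open map has a continuous section over the image of any open set on which it is
injective. -/
theorem exists_continuous_section_image {X Y : Type*} [TopologicalSpace X] [TopologicalSpace Y]
    {p : X → Y} (hc : Continuous p) (ho : IsOpenMap p) {W : Set X} (hW : IsOpen W)
    (hi : Set.InjOn p W) : ∃ s : p '' W → X, Continuous s ∧ ∀ b, p (s b) = b := by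
  have he : IsOpenEmbedding (W.domRestrict p) := .of_continuous_injective_isOpenMap
    (hc.comp continuous_subtype_val) hi.injective (ho.comp hW.isOpenMap_subtype_val)
  let f := he.isEmbedding.toHomeomorph
  have hr : ∀ b : p '' W, (b : Y) ∈ Set.range (W.domRestrict p) := fun b => by
    rw [Set.range_domRestrict]
    exact b.2
  refine ⟨fun b => (f.symm ⟨b, hr b⟩ : X), ?_, fun b => ?_⟩
  · fun_prop
  · exact congrArg Subtype.val (f.apply_symm_apply ⟨b, hr b⟩)

/-- A space covered by the images of local homeomorphisms from `H` is charted on `H`. -/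
theorem nonempty_chartedSpace_of_isLocalHomeomorph {H X : Type*} [TopologicalSpace H]
    [TopologicalSpace X] (h : ∀ x : X, ∃ f : H → X, IsLocalHomeomorph f ∧ x ∈ Set.range f) :
    Nonempty (ChartedSpace H X) := by
  have h1 : ∀ x : X, ∃ e : OpenPartialHomeomorph X H, x ∈ e.source := by
    intro x
    obtain ⟨f, hf, y, rfl⟩ := h x
    obtain ⟨e, he, rfl⟩ := hf y
    exact ⟨e.symm, e.map_source he⟩
  choose e he using h1
  exact ⟨{ atlas := Set.range e
           chartAt := e
           mem_chart_source := he
           chart_mem_atlas := fun x => ⟨x, rfl⟩ }⟩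

/-! ### The finite group `K`, the circle `H`, and freeness -/

/-- The unitary group `U₃`. -/
abbrev U3 : Type := Matrix.unitaryGroup (Fin 3) ℂ

namespace U3

/-- The class of a unitary matrix in `PU₃`. -/
def mk (g : U3) : PU3 := QuotientGroup.mk g

theorem mk_mul (g g' : U3) : mk (g * g') = mk g * mk g' := rfl

theorem mk_pow (g : U3) (n : ℕ) : mk (g ^ n) = mk g ^ n := rfl

theorem mk_surjective : Function.Surjective mk := QuotientGroup.mk_surjective

theorem sum_row_mul_star (g : U3) (i j : Fin 3) :
    ∑ k, g.1 i k * star (g.1 j k) = if i = j then 1 else 0 := by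
  have h := congrFun (congrFun (Matrix.mem_unitaryGroup_iff.mp g.2) i) j
  rwa [Matrix.mul_apply, Matrix.one_apply] at h

end U3

theorem isPrimitiveRoot_cubeRoot : IsPrimitiveRoot cubeRoot 3 :=
  Complex.isPrimitiveRoot_exp 3 (by norm_num)

theorem cubeRoot_ne_zero : cubeRoot ≠ 0 := Complex.exp_ne_zero _

theorem cubeRoot_pow_three : cubeRoot ^ 3 = 1 := isPrimitiveRoot_cubeRoot.pow_eq_one

theorem cubeRoot_ne_one : cubeRoot ≠ 1 := isPrimitiveRoot_cubeRoot.ne_one (by norm_num)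

theorem one_add_cubeRoot_add_sq : 1 + cubeRoot + cubeRoot ^ 2 = 0 := by
  have h : (cubeRoot - 1) * (1 + cubeRoot + cubeRoot ^ 2) = 0 := by
    linear_combination cubeRoot_pow_three
  exact (mul_eq_zero.mp h).resolve_left (sub_ne_zero.mpr cubeRoot_ne_one)

theorem cubeRoot_sq_ne_one : cubeRoot ^ 2 ≠ 1 :=
  isPrimitiveRoot_cubeRoot.pow_ne_one_of_pos_of_lt (by norm_num) (by norm_num)

theorem cubeRoot_sq_ne_cubeRoot : cubeRoot ^ 2 ≠ cubeRoot := fun h =>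
  cubeRoot_ne_one (mul_left_cancel₀ cubeRoot_ne_zero (by rw [← sq, h, mul_one]))

namespace U3

/-- Commuting with `B`, whose eigenvalues are distinct, forces a diagonal matrix; commuting with `A`
makes the diagonal entries equal. -/
theorem exists_eq_smul_one_of_mem_center {g : U3} (hg : g ∈ Subgroup.center U3) :
    ∃ c : Circle, g.1 = (c : ℂ) • (1 : Matrix (Fin 3) (Fin 3) ℂ) := by
  have hB := congrArg Subtype.val (Subgroup.mem_center_iff.mp hg unitaryB)
  have hA := congrArg Subtype.val (Subgroup.mem_center_iff.mp hg unitaryA)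
  change Matrix.diagonal ![1, cubeRoot, cubeRoot ^ 2] * g.1 =
    g.1 * Matrix.diagonal ![1, cubeRoot, cubeRoot ^ 2] at hB
  change !![0, 0, 1; 1, 0, 0; 0, 1, 0] * g.1 = g.1 * !![0, 0, 1; 1, 0, 0; 0, 1, 0] at hA
  have hoff : ∀ i j, i ≠ j → g.1 i j = 0 := by
    intro i j hij
    have h := congrFun (congrFun hB i) j
    rw [Matrix.diagonal_mul, Matrix.mul_diagonal, mul_comm, ← sub_eq_zero, ← mul_sub] at h
    refine (mul_eq_zero.mp h).resolve_right (sub_ne_zero.mpr ?_)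
    have h1 := cubeRoot_ne_one
    have h2 := cubeRoot_sq_ne_one
    have h3 := cubeRoot_sq_ne_cubeRoot
    fin_cases i <;> fin_cases j <;> first | exact absurd rfl hij | skip
    · exact h1.symm
    · exact h2.symm
    · exact h1
    · exact h3.symm
    · exact h2
    · exact h3
  have h10 : g.1 1 1 = g.1 0 0 := by
    have h := congrFun (congrFun hA 1) 0
    simp [Matrix.mul_apply, Fin.sum_univ_three] at h
    exact h.symm
  have h20 : g.1 2 2 = g.1 0 0 := by
    have h := congrFun (congrFun hA 0) 2
    simp [Matrix.mul_apply, Fin.sum_univ_three] at h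
    exact h
  have hn : ‖g.1 0 0‖ = 1 := by
    have h := sum_row_mul_star g 0 0
    rw [Fin.sum_univ_three, hoff 0 1 (by decide), hoff 0 2 (by decide), Complex.star_def,
      Complex.mul_conj'] at h
    have h' : ‖g.1 0 0‖ ^ 2 = 1 := by
      simpa only [Fin.isValue, mul_zero, star_zero, zero_mul, add_zero, if_true,
        ← Complex.ofReal_pow, Complex.ofReal_eq_one] using h
    exact (pow_eq_one_iff_of_nonneg (norm_nonneg _) two_ne_zero).mp h'
  refine ⟨⟨g.1 0 0, mem_sphere_zero_iff_norm.mpr hn⟩, ?_⟩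
  ext i j
  rw [Matrix.smul_apply, Matrix.one_apply]
  split_ifs with hij
  · subst hij
    fin_cases i
    · simp
    · simpa using h10
    · simpa using h20
  · simpa using hoff i j hij

theorem mk_eq_mk_iff {g g' : U3} : mk g = mk g' ↔ ∃ c : Circle, g'.1 = (c : ℂ) • g.1 := by
  refine QuotientGroup.eq.trans ⟨fun h => ?_, fun ⟨c, hc⟩ => ?_⟩
  · obtain ⟨c, hc⟩ := exists_eq_smul_one_of_mem_center h
    refine ⟨c, ?_⟩
    have h1 : g' = g * (g⁻¹ * g') := by group
    rw [h1, Submonoid.coe_mul, hc, mul_smul_comm, mul_one]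
  · have h1 : (g⁻¹ * g').1 = (c : ℂ) • (1 : Matrix (Fin 3) (Fin 3) ℂ) := by
      rw [Submonoid.coe_mul, hc, mul_smul_comm, ← Submonoid.coe_mul, inv_mul_cancel,
        Submonoid.coe_one]
    rw [Subgroup.mem_center_iff]
    intro u
    refine Subtype.ext ?_
    change u.1 * (g⁻¹ * g').1 = (g⁻¹ * g').1 * u.1
    rw [h1, mul_smul_comm, smul_mul_assoc, mul_one, one_mul]

theorem unitaryA_pow_three : unitaryA ^ 3 = 1 := by
  refine Subtype.ext ?_
  change (!![0, 0, 1; 1, 0, 0; 0, 1, 0] : Matrix (Fin 3) (Fin 3) ℂ) ^ 3 = 1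
  ext i j
  fin_cases i <;> fin_cases j <;> simp [pow_succ, Matrix.mul_apply, Fin.sum_univ_three]

theorem unitaryB_pow_three : unitaryB ^ 3 = 1 := by
  refine Subtype.ext ?_
  change Matrix.diagonal ![1, cubeRoot, cubeRoot ^ 2] ^ 3 = 1
  rw [Matrix.diagonal_pow, ← Matrix.diagonal_one]
  congr 1
  have h := cubeRoot_pow_three
  funext i
  fin_cases i
  · simp
  · simpa using h
  · change (cubeRoot ^ 2) ^ 3 = 1
    rw [← pow_mul, mul_comm, pow_mul, h, one_pow]

/-- In `U₃` the commutator is the scalar `w`, since `BA = wAB`. -/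
theorem commute_mk_unitaryA_mk_unitaryB : Commute (mk unitaryA) (mk unitaryB) := by
  change mk (unitaryA * unitaryB) = mk (unitaryB * unitaryA)
  refine mk_eq_mk_iff.mpr ⟨⟨cubeRoot, mem_sphere_zero_iff_norm.mpr
    (isPrimitiveRoot_cubeRoot.norm'_eq_one (by norm_num))⟩, ?_⟩
  change Matrix.diagonal ![1, cubeRoot, cubeRoot ^ 2] * !![0, 0, 1; 1, 0, 0; 0, 1, 0] =
    cubeRoot • (!![0, 0, 1; 1, 0, 0; 0, 1, 0] * Matrix.diagonal ![1, cubeRoot, cubeRoot ^ 2])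
  have h := cubeRoot_pow_three
  ext i j
  rw [Matrix.diagonal_mul, Matrix.smul_apply, Matrix.mul_diagonal]
  fin_cases i <;> fin_cases j <;> simp
  · rw [← pow_succ', h]
  · rw [sq]

end U3

open U3

theorem exists_eq_pow_mul_pow_of_mem_subgroupK {k : PU3} (hk : k ∈ subgroupK) :
    ∃ i j : Fin 3, k = mk (unitaryA ^ (i : ℕ) * unitaryB ^ (j : ℕ)) := by
  have hA : mk unitaryA ^ 3 = 1 := congrArg mk unitaryA_pow_three
  have hB : mk unitaryB ^ 3 = 1 := congrArg mk unitaryB_pow_three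
  have hc := commute_mk_unitaryA_mk_unitaryB
  suffices h : ∃ i j : ℕ, k = mk unitaryA ^ i * mk unitaryB ^ j by
    obtain ⟨i, j, rfl⟩ := h
    refine ⟨⟨i % 3, Nat.mod_lt _ (by norm_num)⟩, ⟨j % 3, Nat.mod_lt _ (by norm_num)⟩, ?_⟩
    rw [mk_mul, mk_pow, mk_pow, ← pow_eq_pow_mod i hA, ← pow_eq_pow_mod j hB]
  refine Subgroup.closure_induction (p := fun k _ => ∃ i j : ℕ, k = mk unitaryA ^ i *
    mk unitaryB ^ j) ?_ ?_ ?_ ?_ hk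
  · rintro _ (rfl | rfl)
    · exact ⟨1, 0, by rw [pow_one, pow_zero, mul_one]; rfl⟩
    · exact ⟨0, 1, by rw [pow_one, pow_zero, one_mul]; rfl⟩
  · exact ⟨0, 0, by simp⟩
  · rintro _ _ _ _ ⟨i, j, rfl⟩ ⟨i', j', rfl⟩
    refine ⟨i + i', j + j', ?_⟩
    rw [pow_add, pow_add, mul_assoc, ← mul_assoc (mk unitaryB ^ j),
      (hc.symm.pow_pow j i').eq, mul_assoc, mul_assoc]
  · rintro _ _ ⟨i, j, rfl⟩
    -- Both generators have cube `1`, so doubling an exponent inverts the power.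
    refine ⟨2 * i, 2 * j, inv_eq_of_mul_eq_one_right ?_⟩
    rw [mul_assoc, ← mul_assoc (mk unitaryB ^ j), (hc.symm.pow_pow j (2 * i)).eq,
      mul_assoc (mk unitaryA ^ (2 * i)), ← mul_assoc, ← pow_add, ← pow_add,
      show i + 2 * i = 3 * i by ring, show j + 2 * j = 3 * j by ring, pow_mul, pow_mul, hA, hB,
      one_pow, one_pow, mul_one]

instance finite_subgroupK : Finite subgroupK := by
  have h : (subgroupK : Set PU3) ⊆ Set.range
      fun p : Fin 3 × Fin 3 => mk (unitaryA ^ (p.1 : ℕ) * unitaryB ^ (p.2 : ℕ)) := by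
    intro k hk
    obtain ⟨i, j, rfl⟩ := exists_eq_pow_mul_pow_of_mem_subgroupK hk
    exact ⟨(i, j), rfl⟩
  exact ((Set.finite_range _).subset h).to_subtype

/-- For `i ≠ 0` the diagonal of `A ^ i` is zero; for `i = 0` the trace is the sum of the three cube
roots of unity. -/
theorem trace_unitaryA_pow_mul_unitaryB_pow {i j : Fin 3} (h : ¬(i = 0 ∧ j = 0)) :
    (unitaryA ^ (i : ℕ) * unitaryB ^ (j : ℕ)).1.trace = 0 := by
  change ((!![0, 0, 1; 1, 0, 0; 0, 1, 0] : Matrix (Fin 3) (Fin 3) ℂ) ^ (i : ℕ) *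
    Matrix.diagonal ![1, cubeRoot, cubeRoot ^ 2] ^ (j : ℕ)).trace = 0
  have h1 := one_add_cubeRoot_add_sq
  have h2 : 1 + cubeRoot ^ 2 + (cubeRoot ^ 2) ^ 2 = 0 := by
    linear_combination h1 + cubeRoot * cubeRoot_pow_three
  rw [Matrix.diagonal_pow, Matrix.trace_fin_three]
  simp only [Matrix.mul_diagonal]
  fin_cases i
  · fin_cases j
    · exact absurd ⟨rfl, rfl⟩ h
    · simpa using h1
    · simpa using h2
  · simp
  · simp [sq, Matrix.mul_apply, Fin.sum_univ_three]

theorem exists_mk_eq_trace_eq_zero_of_mem_subgroupK {k : PU3} (hk : k ∈ subgroupK)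
    (h1 : k ≠ 1) : ∃ g : U3, mk g = k ∧ g.1.trace = 0 := by
  obtain ⟨i, j, rfl⟩ := exists_eq_pow_mul_pow_of_mem_subgroupK hk
  refine ⟨_, rfl, trace_unitaryA_pow_mul_unitaryB_pow ?_⟩
  rintro ⟨rfl, rfl⟩
  refine h1 ?_
  change mk (unitaryA ^ 0 * unitaryB ^ 0) = 1
  rw [pow_zero, pow_zero, one_mul]
  rfl

theorem mem_subgroupH_iff {h : PU3} : h ∈ subgroupH ↔ ∃ z : Circle, h = mk (unitaryDiag z) :=
  ⟨fun ⟨z, hz⟩ => ⟨z, hz.symm⟩, fun ⟨z, hz⟩ => ⟨z, hz.symm⟩⟩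

theorem eq_one_of_conj_mem_subgroupH {g k : PU3} (hk : k ∈ subgroupK)
    (h : g * k * g⁻¹ ∈ subgroupH) : k = 1 := by
  by_contra h1
  obtain ⟨κ, rfl, hκ⟩ := exists_mk_eq_trace_eq_zero_of_mem_subgroupK hk h1
  obtain ⟨γ, rfl⟩ := mk_surjective g
  obtain ⟨z, hz⟩ := mem_subgroupH_iff.mp h
  obtain ⟨c, hc⟩ := mk_eq_mk_iff.mp (show mk (γ * κ * γ⁻¹) = mk (unitaryDiag z) from hz)
  have ht := congrArg Matrix.trace hc
  have h2 : (γ * κ * γ⁻¹).1.trace = 0 := by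
    rw [Submonoid.coe_mul, Matrix.trace_mul_comm, ← Submonoid.coe_mul, ← mul_assoc, inv_mul_cancel,
      one_mul, hκ]
  rw [Matrix.trace_smul, h2, smul_zero] at ht
  change (Matrix.diagonal ![1, (z : ℂ), (z : ℂ)]).trace = 0 at ht
  rw [Matrix.trace_diagonal, Fin.sum_univ_three] at ht
  -- Impossible, since the norms of the two sides are `1` and `2`.
  have h3 : (1 : ℂ) = -(2 * z) := by
    simp at ht
    linear_combination ht
  have h4 := congrArg norm h3
  rw [norm_neg, norm_mul, Circle.norm_coe] at h4
  norm_num at h4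

theorem projH_eq_projH_iff {x y : PU3} : projH x = projH y ↔ x * y⁻¹ ∈ subgroupH := by
  refine Quotient.eq.trans ⟨?_, fun h => ⟨⟨_, h⟩, inv_mul_cancel_right x y⟩⟩
  rintro ⟨h, rfl⟩
  change (h : PU3) * y * y⁻¹ ∈ subgroupH
  rw [mul_inv_cancel_right]
  exact h.2

theorem projH_mk_eq_projH_mk_iff {g g' : U3} : projH (mk g) = projH (mk g') ↔
    ∃ a b : Circle, ∀ j, g.1 0 j = a * g'.1 0 j ∧ g.1 1 j = b * g'.1 1 j ∧
      g.1 2 j = b * g'.1 2 j := by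
  have hd : ∀ (z : Circle) j, (unitaryDiag z * g').1 0 j = g'.1 0 j ∧
      (unitaryDiag z * g').1 1 j = z * g'.1 1 j ∧ (unitaryDiag z * g').1 2 j = z * g'.1 2 j := by
    intro z j
    change (Matrix.diagonal ![1, (z : ℂ), (z : ℂ)] * g'.1) 0 j = _ ∧
      (Matrix.diagonal ![1, (z : ℂ), (z : ℂ)] * g'.1) 1 j = _ ∧
      (Matrix.diagonal ![1, (z : ℂ), (z : ℂ)] * g'.1) 2 j = _
    simp only [Matrix.diagonal_mul]
    simp
  rw [projH_eq_projH_iff, mem_subgroupH_iff]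
  constructor
  · rintro ⟨z, hz⟩
    obtain ⟨c, hc⟩ := mk_eq_mk_iff.mp
      (show mk (unitaryDiag z * g') = mk g by rw [mk_mul, ← hz, inv_mul_cancel_right])
    refine ⟨c, c * z, fun j => ?_⟩
    obtain ⟨h0, h1, h2⟩ := hd z j
    rw [hc, Matrix.smul_apply, Matrix.smul_apply, Matrix.smul_apply, h0, h1, h2]
    simp [mul_assoc]
  · rintro ⟨a, b, h⟩
    refine ⟨b / a, mul_inv_eq_of_eq_mul (Eq.symm ?_)⟩
    rw [← mk_mul]
    refine mk_eq_mk_iff.mpr ⟨a, ?_⟩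
    ext i j
    obtain ⟨h0, h1, h2⟩ := h j
    obtain ⟨h0', h1', h2'⟩ := hd (b / a) j
    have ha : (a : ℂ) ≠ 0 := a.coe_ne_zero
    rw [Matrix.smul_apply, smul_eq_mul]
    fin_cases i
    · exact h0.trans (congrArg _ h0'.symm)
    · refine h1.trans ((?_ : _ = _).trans (congrArg _ h1'.symm))
      rw [Circle.coe_div]
      field_simp
    · refine h2.trans ((?_ : _ = _).trans (congrArg _ h2'.symm))
      rw [Circle.coe_div]
      field_simp

/-! ### Topology of the quotients and an equivariant embedding of `H \ PU₃` -/

instance compactSpace_U3 : CompactSpace U3 := by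
  refine isCompact_iff_compactSpace.mp ?_
  have hK : IsCompact {M : Matrix (Fin 3) (Fin 3) ℂ | ∀ i, M i ∈
      {v : Fin 3 → ℂ | ∀ j, v j ∈ Metric.closedBall (0 : ℂ) 1}} :=
    isCompact_pi_infinite fun _ => isCompact_pi_infinite fun _ => isCompact_closedBall 0 1
  refine hK.of_isClosed_subset ?_ fun M hM i j => ?_
  · have h : (Matrix.unitaryGroup (Fin 3) ℂ : Set (Matrix (Fin 3) (Fin 3) ℂ)) =
        {M | M * star M = 1} := Set.ext fun M => Matrix.mem_unitaryGroup_iff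
    rw [h]
    exact isClosed_eq (by fun_prop) continuous_const
  · exact mem_closedBall_zero_iff.mpr (entry_norm_bound_of_unitary hM i j)

instance secondCountableTopology_U3 : SecondCountableTopology U3 :=
  have : SecondCountableTopology (Matrix (Fin 3) (Fin 3) ℂ) :=
    inferInstanceAs (SecondCountableTopology (Fin 3 → Fin 3 → ℂ))
  TopologicalSpace.Subtype.secondCountableTopology _

instance isClosed_center_U3 : IsClosed (Subgroup.center U3 : Set U3) := by
  have h : (Subgroup.center U3 : Set U3) = ⋂ u : U3, {g | u * g = g * u} := by
    ext g
    simp [Subgroup.mem_center_iff]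
  rw [h]
  exact isClosed_iInter fun u => isClosed_eq (by fun_prop) (by fun_prop)

theorem U3.continuous_mk : Continuous mk := QuotientGroup.continuous_mk

theorem U3.isOpenMap_mk : IsOpenMap mk := QuotientGroup.isOpenMap_coe

theorem continuous_projH : Continuous projH := continuous_quotient_mk'

theorem isOpenMap_projH : IsOpenMap projH := isOpenMap_quotient_mk'_mul

theorem projH_mul_eq_projH_mul {x y : PU3} (h : projH x = projH y) (u : PU3) :
    projH (x * u) = projH (y * u) := by
  rw [projH_eq_projH_iff] at h ⊢
  simpa [mul_assoc] using h

theorem U3.continuous_entry (i j : Fin 3) : Continuous fun g : U3 => g.1 i j :=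
  continuous_subtype_val.matrix_elem i j

/-- Pairs of complex `3 × 3` arrays. -/
abbrev ArrayPair : Type := (Fin 3 → Fin 3 → ℂ) × (Fin 3 → Fin 3 → ℂ)

/-- The products `g* E₁₁ g` and `g* E₂₃ g`, which determine `g` up to `diag(a, b, b)`. -/
noncomputable def U3.invariants (g : U3) : ArrayPair :=
  (fun i j => star (g.1 0 i) * g.1 0 j, fun i j => star (g.1 1 i) * g.1 2 j)

theorem U3.continuous_invariants : Continuous U3.invariants :=
  .prodMk
    (continuous_pi fun i => continuous_pi fun j =>
      (continuous_entry 0 i).star.mul (continuous_entry 0 j))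
    (continuous_pi fun i => continuous_pi fun j =>
      (continuous_entry 1 i).star.mul (continuous_entry 2 j))

theorem Circle.star_coe_mul_coe (z : Circle) : star (z : ℂ) * z = 1 := by
  rw [Complex.star_def, ← Complex.normSq_eq_conj_mul_self, Circle.normSq_coe, Complex.ofReal_one]

theorem U3.invariants_eq_invariants_iff {g g' : U3} :
    g.invariants = g'.invariants ↔ projH (mk g) = projH (mk g') := by
  rw [projH_mk_eq_projH_mk_iff]
  constructor
  · intro h
    have h0 : ∀ i j, star (g.1 0 i) * g.1 0 j = star (g'.1 0 i) * g'.1 0 j := fun i j =>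
      congrFun (congrFun (congrArg Prod.fst h) i) j
    have h1 : ∀ i j, star (g.1 1 i) * g.1 2 j = star (g'.1 1 i) * g'.1 2 j := fun i j =>
      congrFun (congrFun (congrArg Prod.snd h) i) j
    have hn : ∀ (g : U3) i, g.1 i 0 * star (g.1 i 0) + g.1 i 1 * star (g.1 i 1) +
        g.1 i 2 * star (g.1 i 2) = 1 := fun g i => by
      simpa [Fin.sum_univ_three] using sum_row_mul_star g i i
    have hunit : ∀ (i : Fin 3) (c : ℂ), (∀ j, g.1 i j = c * g'.1 i j) → ‖c‖ = 1 := by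
      intro i c hc
      have h := hn g i
      simp only [hc, star_mul'] at h
      have h2 : c * star c = 1 := by linear_combination h - c * star c * hn g' i
      rw [Complex.star_def, Complex.mul_conj'] at h2
      have h' : ‖c‖ ^ 2 = 1 := by
        simpa only [← Complex.ofReal_pow, Complex.ofReal_eq_one] using h2
      exact (pow_eq_one_iff_of_nonneg (norm_nonneg _) two_ne_zero).mp h'
    -- The factor is the inner product of the two first rows: insert `∑ |g₀ᵢ|² = 1` and replace
    -- `star g₀ᵢ * g₀ⱼ` by its counterpart for `g'`. The factor relating the last rows is likewise
    -- the inner product of the middle rows.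
    obtain ⟨a, ha⟩ : ∃ a : ℂ, ∀ j, g.1 0 j = a * g'.1 0 j := by
      refine ⟨g.1 0 0 * star (g'.1 0 0) + g.1 0 1 * star (g'.1 0 1) +
        g.1 0 2 * star (g'.1 0 2), fun j => ?_⟩
      linear_combination -g.1 0 j * hn g 0 + g.1 0 0 * h0 0 j + g.1 0 1 * h0 1 j +
        g.1 0 2 * h0 2 j
    obtain ⟨b, hb⟩ : ∃ b : ℂ, ∀ j, g.1 2 j = b * g'.1 2 j := by
      refine ⟨g.1 1 0 * star (g'.1 1 0) + g.1 1 1 * star (g'.1 1 1) +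
        g.1 1 2 * star (g'.1 1 2), fun j => ?_⟩
      linear_combination -g.1 2 j * hn g 1 + g.1 1 0 * h1 0 j + g.1 1 1 * h1 1 j +
        g.1 1 2 * h1 2 j
    have hb1 := hunit 2 b hb
    have hbb : star b * b = 1 := Circle.star_coe_mul_coe ⟨b, mem_sphere_zero_iff_norm.mpr hb1⟩
    have hb' : ∀ j, g.1 1 j = b * g'.1 1 j := by
      intro j
      have h2 : star (g.1 1 j) = star (g'.1 1 j) * star b := by
        have h3 : star (g.1 1 j) * b = star (g'.1 1 j) := by
          have e0 := h1 j 0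
          have e1 := h1 j 1
          have e2 := h1 j 2
          rw [hb] at e0 e1 e2
          linear_combination (star (g'.1 1 j) - star (g.1 1 j) * b) * hn g' 2 +
            star (g'.1 2 0) * e0 + star (g'.1 2 1) * e1 + star (g'.1 2 2) * e2
        linear_combination star b * h3 - star (g.1 1 j) * hbb
      have h4 := congrArg star h2
      rwa [star_star, star_mul, star_star, star_star] at h4
    exact ⟨⟨a, mem_sphere_zero_iff_norm.mpr (hunit 0 a ha)⟩,
      ⟨b, mem_sphere_zero_iff_norm.mpr hb1⟩, fun j => ⟨ha j, hb' j, hb j⟩⟩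
  · rintro ⟨a, b, h⟩
    have ha := Circle.star_coe_mul_coe a
    have hb := Circle.star_coe_mul_coe b
    refine Prod.ext (funext fun i => funext fun j => ?_) (funext fun i => funext fun j => ?_)
    · change star (g.1 0 i) * g.1 0 j = star (g'.1 0 i) * g'.1 0 j
      rw [(h i).1, (h j).1, star_mul']
      linear_combination star (g'.1 0 i) * g'.1 0 j * ha
    · change star (g.1 1 i) * g.1 2 j = star (g'.1 1 i) * g'.1 2 j
      rw [(h i).2.1, (h j).2.2, star_mul']
      linear_combination star (g'.1 1 i) * g'.1 2 j * hb

/-- The map on `H \ PU₃` induced by `U3.invariants`. -/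
noncomputable def HCosets.invariants : HCosets → ArrayPair :=
  Quotient.lift (Quotient.lift U3.invariants fun g g' h => by
      have h1 : mk g = mk g' := Quotient.sound h
      rw [invariants_eq_invariants_iff, h1]) (by
    intro x y h
    obtain ⟨g, rfl⟩ := mk_surjective x
    obtain ⟨g', rfl⟩ := mk_surjective y
    exact invariants_eq_invariants_iff.mpr (Quotient.sound h))

theorem HCosets.continuous_invariants : Continuous HCosets.invariants :=
  .quotient_lift (.quotient_lift U3.continuous_invariants _) _

theorem exists_projH_mk_eq (x : HCosets) : ∃ g : U3, projH (mk g) = x := by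
  obtain ⟨y, rfl⟩ := Quotient.exists_rep x
  obtain ⟨g, rfl⟩ := mk_surjective y
  exact ⟨g, rfl⟩

theorem HCosets.invariants_injective : Function.Injective HCosets.invariants := by
  intro x y h
  obtain ⟨g, rfl⟩ := exists_projH_mk_eq x
  obtain ⟨g', rfl⟩ := exists_projH_mk_eq y
  exact invariants_eq_invariants_iff.mp h

instance t2Space_HCosets : T2Space HCosets :=
  .of_injective_continuous HCosets.invariants_injective HCosets.continuous_invariants

/-- The map `e ↦ u* e u` on complex `3 × 3` arrays. -/
noncomputable def conjArray (u : U3) : (Fin 3 → Fin 3 → ℂ) →ₗ[ℂ] (Fin 3 → Fin 3 → ℂ) where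
  toFun e i j := ∑ k, ∑ l, star (u.1 k i) * e k l * u.1 l j
  map_add' e e' := by
    ext i j
    simp only [Pi.add_apply, mul_add, add_mul, Finset.sum_add_distrib]
  map_smul' c e := by
    ext i j
    simp only [Pi.smul_apply, smul_eq_mul, Finset.mul_sum, RingHom.id_apply]
    exact Finset.sum_congr rfl fun k _ => Finset.sum_congr rfl fun l _ => by ring

/-- Both components have the form `g* E g` with `E` fixed, so right multiplication becomes
conjugation. This linear, hence Lipschitz, action is what the covering argument requires. -/
theorem U3.invariants_mul (g u : U3) :
    (g * u).invariants = (conjArray u).prodMap (conjArray u) g.invariants := by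
  have h : ∀ a b i j, star ((g * u).1 a i) * (g * u).1 b j =
      ∑ k, ∑ l, star (u.1 k i) * (star (g.1 a k) * g.1 b l) * u.1 l j := by
    intro a b i j
    rw [Submonoid.coe_mul, Matrix.mul_apply, Matrix.mul_apply, star_sum, Finset.sum_mul_sum]
    refine Finset.sum_congr rfl fun k _ => Finset.sum_congr rfl fun l _ => ?_
    rw [star_mul']
    ring
  exact Prod.ext (funext fun i => funext fun j => h 0 0 i j)
    (funext fun i => funext fun j => h 1 2 i j)

/-! ### Coordinates on `H \ PU₃` -/

/-- The phase `w / ‖w‖` of a complex number. -/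
noncomputable def phase (w : ℂ) : Circle := Circle.exp w.arg

theorem phase_mul_norm (w : ℂ) : (phase w : ℂ) * ‖w‖ = w := by
  rw [mul_comm, phase, Circle.coe_exp, Complex.norm_mul_exp_arg_mul_I]

theorem phase_coe_mul {z : Circle} {r : ℝ} (hr : 0 < r) : phase (z * r) = z := by
  have h := phase_mul_norm (z * r)
  rw [norm_mul, Circle.norm_coe, one_mul, Complex.norm_of_nonneg hr.le] at h
  exact Circle.ext (mul_right_cancel₀ (Complex.ofReal_ne_zero.mpr hr.ne') h)

/-- The jump of the argument disappears on the circle, where the phase is `v / ‖v‖`. -/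
theorem continuousAt_phase {w : ℂ} (hw : w ≠ 0) : ContinuousAt phase w := by
  have hi : Topology.IsInducing ((↑) : Circle → ℂ) := ⟨rfl⟩
  refine hi.continuousAt_iff.mpr ?_
  have h : ContinuousAt (fun v : ℂ => v / ‖v‖) w :=
    continuousAt_id.div (Complex.continuous_ofReal.comp continuous_norm).continuousAt
      (Complex.ofReal_ne_zero.mpr (norm_ne_zero_iff.mpr hw))
  refine h.congr ?_
  filter_upwards [isOpen_ne.mem_nhds hw] with v hv
  exact (div_eq_iff (Complex.ofReal_ne_zero.mpr (norm_ne_zero_iff.mpr hv))).mpr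
    (phase_mul_norm v).symm

/-- The matrix with first row `u`, last row `v`, and middle row `z` times the conjugate of the
cross product of `v` and `u`. -/
noncomputable def rowsMatrix (u v : Fin 3 → ℂ) (z : ℂ) : Matrix (Fin 3) (Fin 3) ℂ :=
  ![u, ![z * star (v 1 * u 2 - v 2 * u 1), z * star (v 2 * u 0 - v 0 * u 2),
    z * star (v 0 * u 1 - v 1 * u 0)], v]

theorem rowsMatrix_mem_unitaryGroup {u v : Fin 3 → ℂ}
    (hu : u 0 * star (u 0) + u 1 * star (u 1) + u 2 * star (u 2) = 1)
    (hv : v 0 * star (v 0) + v 1 * star (v 1) + v 2 * star (v 2) = 1)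
    (huv : u 0 * star (v 0) + u 1 * star (v 1) + u 2 * star (v 2) = 0) (z : Circle) :
    rowsMatrix u v z ∈ Matrix.unitaryGroup (Fin 3) ℂ := by
  rw [Matrix.mem_unitaryGroup_iff]
  have hvu : v 0 * star (u 0) + v 1 * star (u 1) + v 2 * star (u 2) = 0 := by
    have h := congrArg star huv
    simp only [star_add, star_mul', star_star, star_zero] at h
    linear_combination h
  have hz := Circle.star_coe_mul_coe z
  -- Lagrange's identity `|v × u|² = |u|² |v|² - |⟨v, u⟩|²`.
  have h11 : star (v 1 * u 2 - v 2 * u 1) * (v 1 * u 2 - v 2 * u 1) +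
      star (v 2 * u 0 - v 0 * u 2) * (v 2 * u 0 - v 0 * u 2) +
      star (v 0 * u 1 - v 1 * u 0) * (v 0 * u 1 - v 1 * u 0) = 1 := by
    simp only [star_sub, star_mul']
    linear_combination (v 0 * star (v 0) + v 1 * star (v 1) + v 2 * star (v 2)) * hu + hv -
      (v 0 * star (u 0) + v 1 * star (u 1) + v 2 * star (u 2)) * huv
  ext i j
  rw [Matrix.mul_apply, Fin.sum_univ_three]
  simp only [Matrix.star_apply]
  fin_cases i <;> fin_cases j
  · exact hu
  · change u 0 * star ((z : ℂ) * star _) + u 1 * star ((z : ℂ) * star _) + u 2 * star ((z : ℂ) * star _) = 0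
    simp only [star_mul', star_star]
    ring
  · exact huv
  · change (z : ℂ) * star _ * star (u 0) + (z : ℂ) * star _ * star (u 1) + (z : ℂ) * star _ * star (u 2) = 0
    simp only [star_mul', star_sub]
    ring
  · change (z : ℂ) * star (v 1 * u 2 - v 2 * u 1) * star (z * star (v 1 * u 2 - v 2 * u 1)) +
      z * star (v 2 * u 0 - v 0 * u 2) * star (z * star (v 2 * u 0 - v 0 * u 2)) +
      z * star (v 0 * u 1 - v 1 * u 0) * star (z * star (v 0 * u 1 - v 1 * u 0)) = 1
    rw [star_mul', star_mul', star_mul', star_star, star_star, star_star]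
    linear_combination star (z : ℂ) * z * h11 + hz
  · change (z : ℂ) * star _ * star (v 0) + (z : ℂ) * star _ * star (v 1) + (z : ℂ) * star _ * star (v 2) = 0
    simp only [star_mul', star_sub]
    ring
  · exact hvu
  · change v 0 * star ((z : ℂ) * star _) + v 1 * star ((z : ℂ) * star _) + v 2 * star ((z : ℂ) * star _) = 0
    simp only [star_mul', star_star]
    ring
  · exact hv

theorem det_rowsMatrix {u v : Fin 3 → ℂ}
    (hu : u 0 * star (u 0) + u 1 * star (u 1) + u 2 * star (u 2) = 1)
    (hv : v 0 * star (v 0) + v 1 * star (v 1) + v 2 * star (v 2) = 1)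
    (huv : u 0 * star (v 0) + u 1 * star (v 1) + u 2 * star (v 2) = 0) (z : ℂ) :
    (rowsMatrix u v z).det = z := by
  rw [Matrix.det_fin_three]
  change u 0 * (z * star (v 2 * u 0 - v 0 * u 2)) * v 2 -
    u 0 * (z * star (v 0 * u 1 - v 1 * u 0)) * v 1 -
    u 1 * (z * star (v 1 * u 2 - v 2 * u 1)) * v 2 +
    u 1 * (z * star (v 0 * u 1 - v 1 * u 0)) * v 0 +
    u 2 * (z * star (v 1 * u 2 - v 2 * u 1)) * v 1 -
    u 2 * (z * star (v 2 * u 0 - v 0 * u 2)) * v 0 = z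
  simp only [star_sub, star_mul']
  linear_combination z * (v 0 * star (v 0) + v 1 * star (v 1) + v 2 * star (v 2)) * hu + z * hv -
    z * (v 0 * star (u 0) + v 1 * star (u 1) + v 2 * star (u 2)) * huv

/-- The length of `(1, x, y)`. -/
noncomputable def affineNorm (x y : ℂ) : ℝ := √(1 + ‖x‖ ^ 2 + ‖y‖ ^ 2)

theorem affineNorm_pos (x y : ℂ) : 0 < affineNorm x y := Real.sqrt_pos.mpr (by positivity)

theorem affineNorm_sq (x y : ℂ) :
    (affineNorm x y : ℂ) ^ 2 = 1 + x * star x + y * star y := by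
  rw [Complex.star_def, Complex.mul_conj', Complex.mul_conj', affineNorm,
    ← Complex.ofReal_pow, Real.sq_sqrt (by positivity)]
  push_cast
  rfl

/-- The unit vector proportional to `(1, x, y)`. -/
noncomputable def firstRow (x y : ℂ) : Fin 3 → ℂ :=
  fun j => ((affineNorm x y)⁻¹ : ℝ) * ![1, x, y] j

/-- The unit vector proportional to `(star a, -star q, 1)`. -/
noncomputable def lastRow (a q : ℂ) : Fin 3 → ℂ :=
  fun j => ((affineNorm a q)⁻¹ : ℝ) * ![star a, -star q, 1] j

theorem firstRow_norm (x y : ℂ) : firstRow x y 0 * star (firstRow x y 0) +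
    firstRow x y 1 * star (firstRow x y 1) + firstRow x y 2 * star (firstRow x y 2) = 1 := by
  have h := affineNorm_sq x y
  have h0 : (affineNorm x y : ℂ) ≠ 0 := Complex.ofReal_ne_zero.mpr (affineNorm_pos x y).ne'
  simp [firstRow] at h ⊢
  field_simp
  linear_combination -h

theorem lastRow_norm (a q : ℂ) : lastRow a q 0 * star (lastRow a q 0) +
    lastRow a q 1 * star (lastRow a q 1) + lastRow a q 2 * star (lastRow a q 2) = 1 := by
  have h := affineNorm_sq a q
  have h0 : (affineNorm a q : ℂ) ≠ 0 := Complex.ofReal_ne_zero.mpr (affineNorm_pos a q).ne'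
  simp [lastRow] at h ⊢
  field_simp
  linear_combination -h

/-- Orthogonality to `(1, x, y)` reads `a - x q + y = 0`, which explains the choice `a = x * q - y`.
-/
theorem firstRow_mul_star_lastRow (x y q : ℂ) :
    firstRow x y 0 * star (lastRow (x * q - y) q 0) +
      firstRow x y 1 * star (lastRow (x * q - y) q 1) +
      firstRow x y 2 * star (lastRow (x * q - y) q 2) = 0 := by
  simp [firstRow, lastRow]
  ring

/-- The unitary matrices with first row proportional to `(1, x, y)` and last row proportional to
`(star (x * q - y), -star q, 1)`, normalized by diagonal matrices. -/
noncomputable def paramU3 (p : ℂ × ℂ × ℂ × Circle) : U3 :=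
  ⟨rowsMatrix (firstRow p.1 p.2.1) (lastRow (p.1 * p.2.2.1 - p.2.1) p.2.2.1) p.2.2.2,
    rowsMatrix_mem_unitaryGroup (firstRow_norm _ _) (lastRow_norm _ _)
      (firstRow_mul_star_lastRow _ _ _) _⟩

/-- The coordinates of a unitary matrix with respect to the parametrization `paramU3`. -/
noncomputable def U3.coords (g : U3) : ℂ × ℂ × ℂ × Circle :=
  (g.1 0 1 / g.1 0 0, g.1 0 2 / g.1 0 0, -star (g.1 2 1 / g.1 2 2),
    phase (g.1.det / (g.1 0 0 * g.1 2 2 ^ 2)))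

/-- The domain of the coordinates. -/
def coordsDomain : Set U3 := {g | g.1 0 0 ≠ 0 ∧ g.1 2 2 ≠ 0}

theorem isOpen_coordsDomain : IsOpen coordsDomain :=
  (isOpen_ne.preimage (continuous_entry 0 0)).inter (isOpen_ne.preimage (continuous_entry 2 2))

theorem U3.det_ne_zero (g : U3) : g.1.det ≠ 0 := by
  have h := (Unitary.mem_iff.mp (Matrix.det_of_mem_unitary g.2)).1
  intro h0
  rw [h0, mul_zero] at h
  exact zero_ne_one h

theorem continuousOn_coords : ContinuousOn U3.coords coordsDomain := by
  rintro g ⟨h0, h2⟩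
  have hc := fun i j => (continuous_entry i j).continuousAt (x := g)
  have hdet : ContinuousAt (fun g : U3 => g.1.det) g :=
    continuous_subtype_val.matrix_det.continuousAt
  refine ContinuousAt.continuousWithinAt (.prodMk ((hc 0 1).div (hc 0 0) h0)
    (.prodMk ((hc 0 2).div (hc 0 0) h0) (.prodMk ((hc 2 1).div (hc 2 2) h2).star.neg ?_)))
  have h : g.1 0 0 * g.1 2 2 ^ 2 ≠ 0 := mul_ne_zero h0 (pow_ne_zero 2 h2)
  exact ContinuousAt.comp (g := phase) (continuousAt_phase (div_ne_zero g.det_ne_zero h))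
    (hdet.div ((hc 0 0).mul ((hc 2 2).pow 2)) h)

theorem paramU3_zero_zero (p : ℂ × ℂ × ℂ × Circle) :
    (paramU3 p).1 0 0 = ((affineNorm p.1 p.2.1)⁻¹ : ℝ) := mul_one _

theorem paramU3_two_two (p : ℂ × ℂ × ℂ × Circle) : (paramU3 p).1 2 2 =
    ((affineNorm (p.1 * p.2.2.1 - p.2.1) p.2.2.1)⁻¹ : ℝ) := mul_one _

theorem paramU3_mem_coordsDomain (p : ℂ × ℂ × ℂ × Circle) : paramU3 p ∈ coordsDomain := by
  refine ⟨?_, ?_⟩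
  · rw [paramU3_zero_zero]
    exact Complex.ofReal_ne_zero.mpr (inv_pos.mpr (affineNorm_pos _ _)).ne'
  · rw [paramU3_two_two]
    exact Complex.ofReal_ne_zero.mpr (inv_pos.mpr (affineNorm_pos _ _)).ne'

theorem coords_paramU3 (p : ℂ × ℂ × ℂ × Circle) : (paramU3 p).coords = p := by
  obtain ⟨h0, h2⟩ := paramU3_mem_coordsDomain p
  have e0 := paramU3_zero_zero p
  have e2 := paramU3_two_two p
  have hdet : (paramU3 p).1.det = p.2.2.2 :=
    det_rowsMatrix (firstRow_norm _ _) (lastRow_norm _ _) (firstRow_mul_star_lastRow _ _ _) _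
  refine Prod.ext ?_ (Prod.ext ?_ (Prod.ext ?_ ?_))
  · refine (div_eq_iff h0).mpr (Eq.trans ?_ (mul_comm _ _))
    rw [e0]
    rfl
  · refine (div_eq_iff h0).mpr (Eq.trans ?_ (mul_comm _ _))
    rw [e0]
    rfl
  · change -star ((paramU3 p).1 2 1 / (paramU3 p).1 2 2) = p.2.2.1
    have h : (paramU3 p).1 2 1 / (paramU3 p).1 2 2 = -star p.2.2.1 := by
      refine (div_eq_iff h2).mpr (Eq.trans ?_ (mul_comm _ _))
      rw [e2]
      rfl
    rw [h, star_neg, star_star, neg_neg]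
  · change phase ((paramU3 p).1.det / ((paramU3 p).1 0 0 * (paramU3 p).1 2 2 ^ 2)) = p.2.2.2
    rw [hdet, e0, e2, div_eq_mul_inv, ← Complex.ofReal_pow, ← Complex.ofReal_mul,
      ← Complex.ofReal_inv]
    exact phase_coe_mul (inv_pos.mpr (mul_pos (inv_pos.mpr (affineNorm_pos _ _))
      (pow_pos (inv_pos.mpr (affineNorm_pos _ _)) 2)))

/-- Multiplication by `diag(a, b, b)` scales both the determinant and `g₀₀ g₂₂²` by `a b²`, and
leaves ratios within a row unchanged. -/
theorem coords_eq_of_projH_eq {g g' : U3} (h : projH (mk g) = projH (mk g')) :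
    g.coords = g'.coords := by
  obtain ⟨a, b, h⟩ := projH_mk_eq_projH_mk_iff.mp h
  have ha := a.coe_ne_zero
  have hb := b.coe_ne_zero
  have hdet : g.1.det = a * b ^ 2 * g'.1.det := by
    rw [Matrix.det_fin_three, Matrix.det_fin_three]
    simp only [(h _).1, (h _).2.1, (h _).2.2]
    ring
  rw [coords, coords, hdet]
  simp only [(h _).1, (h _).2.2]
  rw [mul_div_mul_left _ _ ha, mul_div_mul_left _ _ ha, mul_div_mul_left _ _ hb,
    show (a * g'.1 0 0 * (b * g'.1 2 2) ^ 2 : ℂ) = a * b ^ 2 * (g'.1 0 0 * g'.1 2 2 ^ 2) by ring,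
    mul_div_mul_left _ _ (mul_ne_zero ha (pow_ne_zero 2 hb))]

theorem affineNorm_div {a b c : ℂ} (ha : a ≠ 0) (h : a * star a + b * star b + c * star c = 1) :
    affineNorm (b / a) (c / a) = ‖a‖⁻¹ := by
  have ha' : ‖a‖ ≠ 0 := norm_ne_zero_iff.mpr ha
  simp only [Complex.star_def, Complex.mul_conj'] at h
  have h' : ‖a‖ ^ 2 + ‖b‖ ^ 2 + ‖c‖ ^ 2 = 1 := mod_cast h
  rw [affineNorm, Real.sqrt_eq_iff_mul_self_eq (by positivity) (by positivity), norm_div, norm_div]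
  field_simp
  linarith

theorem projH_mk_paramU3_coords {g : U3} (hg : g ∈ coordsDomain) :
    projH (mk (paramU3 g.coords)) = projH (mk g) := by
  obtain ⟨h0, h2⟩ := hg
  refine Eq.symm (projH_mk_eq_projH_mk_iff.mpr ⟨phase (g.1 0 0), phase (g.1 2 2), ?_⟩)
  have hn : ∀ i, g.1 i 0 * star (g.1 i 0) + g.1 i 1 * star (g.1 i 1) +
      g.1 i 2 * star (g.1 i 2) = 1 := fun i => by
    simpa [Fin.sum_univ_three] using sum_row_mul_star g i i
  have h02 : g.1 0 0 * star (g.1 2 0) + g.1 0 1 * star (g.1 2 1) +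
      g.1 0 2 * star (g.1 2 2) = 0 := by
    simpa [Fin.sum_univ_three] using sum_row_mul_star g 0 2
  have hs2 : star (g.1 2 2) ≠ 0 := star_ne_zero.mpr h2
  have hα : g.coords.1 * g.coords.2.2.1 - g.coords.2.1 = star (g.1 2 0 / g.1 2 2) := by
    change g.1 0 1 / g.1 0 0 * -star (g.1 2 1 / g.1 2 2) - g.1 0 2 / g.1 0 0 = _
    rw [star_div₀, star_div₀]
    field_simp
    linear_combination -h02
  have hr0 : ∀ j, g.1 0 j = phase (g.1 0 0) * (paramU3 g.coords).1 0 j := by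
    intro j
    have hN : affineNorm (g.1 0 1 / g.1 0 0) (g.1 0 2 / g.1 0 0) = ‖g.1 0 0‖⁻¹ :=
      affineNorm_div h0 (hn 0)
    change g.1 0 j = phase (g.1 0 0) * (((affineNorm (g.1 0 1 / g.1 0 0)
      (g.1 0 2 / g.1 0 0))⁻¹ : ℝ) * ![1, g.1 0 1 / g.1 0 0, g.1 0 2 / g.1 0 0] j)
    rw [hN, inv_inv, ← mul_assoc, phase_mul_norm]
    fin_cases j
    · exact (mul_one _).symm
    · exact (mul_div_cancel₀ _ h0).symm
    · exact (mul_div_cancel₀ _ h0).symm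
  have hr2 : ∀ j, g.1 2 j = phase (g.1 2 2) * (paramU3 g.coords).1 2 j := by
    intro j
    have hN : affineNorm (star (g.1 2 0 / g.1 2 2)) (-star (g.1 2 1 / g.1 2 2)) =
        ‖g.1 2 2‖⁻¹ := by
      rw [affineNorm, norm_star, norm_neg, norm_star]
      exact affineNorm_div h2 (by linear_combination hn 2)
    change g.1 2 j = phase (g.1 2 2) * lastRow (g.coords.1 * g.coords.2.2.1 - g.coords.2.1)
      (-star (g.1 2 1 / g.1 2 2)) j
    rw [hα, lastRow, hN, inv_inv, ← mul_assoc, phase_mul_norm, star_star, star_neg, star_star,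
      neg_neg]
    fin_cases j
    · exact (mul_div_cancel₀ _ h2).symm
    · exact (mul_div_cancel₀ _ h2).symm
    · exact (mul_one _).symm
  refine fun j => ⟨hr0 j, ?_, hr2 j⟩
  have hD : star g.1.det * g.1.det = 1 :=
    (Unitary.mem_iff.mp (Matrix.det_of_mem_unitary g.2)).1
  have hD1 : ‖g.1.det‖ = 1 := CStarRing.norm_of_mem_unitary (Matrix.det_of_mem_unitary g.2)
  let D : Circle := ⟨g.1.det, mem_sphere_zero_iff_norm.mpr hD1⟩
  generalize ha : phase (g.1 0 0) = a at hr0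
  generalize hb : phase (g.1 2 2) = b at hr2
  have hz : g.coords.2.2.2 = D / (a * b ^ 2) := by
    change phase (g.1.det / (g.1 0 0 * g.1 2 2 ^ 2)) = _
    have e : g.1.det / (g.1 0 0 * g.1 2 2 ^ 2) =
        (D / (a * b ^ 2) : Circle) * ((‖g.1 0 0‖ * ‖g.1 2 2‖ ^ 2)⁻¹ : ℝ) := by
      conv_lhs => rw [← phase_mul_norm (g.1 0 0), ← phase_mul_norm (g.1 2 2), ha, hb]
      have ha' := a.coe_ne_zero
      have hb' := b.coe_ne_zero
      have hn0 : (‖g.1 0 0‖ : ℂ) ≠ 0 := Complex.ofReal_ne_zero.mpr (norm_ne_zero_iff.mpr h0)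
      have hn2 : (‖g.1 2 2‖ : ℂ) ≠ 0 := Complex.ofReal_ne_zero.mpr (norm_ne_zero_iff.mpr h2)
      push_cast
      field_simp
      rfl
    rw [e]
    exact phase_coe_mul (inv_pos.mpr (mul_pos (norm_pos_iff.mpr h0)
      (pow_pos (norm_pos_iff.mpr h2) 2)))
  -- Since `g⁻¹ = g*`, cofactors recover the middle row from the other two rows and the determinant,
  -- as in `rowsMatrix`.
  have hadj : ∀ j, g.1.adjugate j 1 = g.1.det * star (g.1 1 j) := by
    have h : g.1.adjugate = g.1.det • star g.1 := by
      calc g.1.adjugate = star g.1 * g.1 * g.1.adjugate := by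
            rw [Matrix.mem_unitaryGroup_iff'.mp g.2, one_mul]
        _ = _ := by rw [mul_assoc, Matrix.mul_adjugate, mul_smul_comm, mul_one]
    intro j
    rw [h]
    rfl
  rw [Matrix.adjugate_fin_three] at hadj
  have ha' := Circle.star_coe_mul_coe a
  have hb' := Circle.star_coe_mul_coe b
  have hzc : (g.coords.2.2.2 : ℂ) * a * b ^ 2 = g.1.det := by
    rw [hz, Circle.coe_div, Circle.coe_mul, Circle.coe_pow]
    have ha' := a.coe_ne_zero
    have hb' := b.coe_ne_zero
    field_simp
    rfl
  have key : ∀ c e : ℂ, a * b * c = g.1.det * star e → e = b * (g.coords.2.2.2 * star c) := by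
    intro c e h
    have h1 := congrArg star h
    simp only [star_mul', star_star] at h1
    linear_combination (-e) * hD - g.1.det * h1 - star (a : ℂ) * star (b : ℂ) * star c * hzc +
      g.coords.2.2.2 * b ^ 2 * star (b : ℂ) * star c * ha' + g.coords.2.2.2 * b * star c * hb'
  have hj := hadj j
  fin_cases j
  · refine key _ _ (Eq.trans ?_ hj)
    change a * b * ((paramU3 g.coords).1 2 1 * (paramU3 g.coords).1 0 2 -
      (paramU3 g.coords).1 2 2 * (paramU3 g.coords).1 0 1) = -(g.1 0 1 * g.1 2 2) + g.1 0 2 * g.1 2 1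
    rw [hr0 1, hr0 2, hr2 1, hr2 2]
    ring
  · refine key _ _ (Eq.trans ?_ hj)
    change a * b * ((paramU3 g.coords).1 2 2 * (paramU3 g.coords).1 0 0 -
      (paramU3 g.coords).1 2 0 * (paramU3 g.coords).1 0 2) = g.1 0 0 * g.1 2 2 - g.1 0 2 * g.1 2 0
    rw [hr0 2, hr0 0, hr2 2, hr2 0]
    ring
  · refine key _ _ (Eq.trans ?_ hj)
    change a * b * ((paramU3 g.coords).1 2 0 * (paramU3 g.coords).1 0 1 -
      (paramU3 g.coords).1 2 1 * (paramU3 g.coords).1 0 0) = -(g.1 0 0 * g.1 2 1) + g.1 0 1 * g.1 2 0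
    rw [hr0 0, hr0 1, hr2 0, hr2 1]
    ring

/-! ### Regularity of the parametrization -/

theorem continuous_affineNorm : Continuous fun p : ℂ × ℂ => affineNorm p.1 p.2 := by
  unfold affineNorm
  fun_prop

theorem contDiff_affineNorm : ContDiff ℝ 1 fun p : ℂ × ℂ => affineNorm p.1 p.2 :=
  ((contDiff_const.add (contDiff_fst.norm_sq ℝ)).add (contDiff_snd.norm_sq ℝ)).sqrt
    fun p => by positivity

theorem continuous_firstRow (j : Fin 3) : Continuous fun p : ℂ × ℂ => firstRow p.1 p.2 j := by
  refine (Complex.continuous_ofReal.comp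
    (continuous_affineNorm.inv₀ fun p => (affineNorm_pos _ _).ne')).mul ?_
  fin_cases j
  exacts [continuous_const, continuous_fst, continuous_snd]

theorem contDiff_firstRow (j : Fin 3) :
    ContDiff ℝ 1 fun p : ℂ × ℂ => firstRow p.1 p.2 j := by
  refine (Complex.ofRealCLM.contDiff.comp
    (contDiff_affineNorm.inv fun p => (affineNorm_pos _ _).ne')).mul ?_
  fin_cases j
  exacts [contDiff_const, contDiff_fst, contDiff_snd]

theorem continuous_lastRow (j : Fin 3) : Continuous fun p : ℂ × ℂ => lastRow p.1 p.2 j := by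
  refine (Complex.continuous_ofReal.comp
    (continuous_affineNorm.inv₀ fun p => (affineNorm_pos _ _).ne')).mul ?_
  fin_cases j
  exacts [continuous_fst.star, continuous_snd.star.neg, continuous_const]

theorem contDiff_star {E : Type*} [NormedAddCommGroup E] [NormedSpace ℝ E] {f : E → ℂ}
    (hf : ContDiff ℝ 1 f) : ContDiff ℝ 1 fun x => star (f x) :=
  Complex.conjCLE.contDiff.comp hf

theorem contDiff_lastRow (j : Fin 3) :
    ContDiff ℝ 1 fun p : ℂ × ℂ => lastRow p.1 p.2 j := by
  refine (Complex.ofRealCLM.contDiff.comp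
    (contDiff_affineNorm.inv fun p => (affineNorm_pos _ _).ne')).mul ?_
  fin_cases j
  exacts [contDiff_star contDiff_fst, (contDiff_star contDiff_snd).neg, contDiff_const]

theorem continuous_paramU3 : Continuous paramU3 := by
  have hu : ∀ j, Continuous fun p : ℂ × ℂ × ℂ × Circle => firstRow p.1 p.2.1 j := fun j =>
    (continuous_firstRow j).comp (f := fun p : ℂ × ℂ × ℂ × Circle => (p.1, p.2.1)) (by fun_prop)
  have hv : ∀ j, Continuous fun p : ℂ × ℂ × ℂ × Circle =>
      lastRow (p.1 * p.2.2.1 - p.2.1) p.2.2.1 j := fun j =>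
    (continuous_lastRow j).comp
      (f := fun p : ℂ × ℂ × ℂ × Circle => (p.1 * p.2.2.1 - p.2.1, p.2.2.1)) (by fun_prop)
  have hz : Continuous fun p : ℂ × ℂ × ℂ × Circle => (p.2.2.2 : ℂ) :=
    (continuous_induced_dom : Continuous ((↑) : Circle → ℂ)).comp (by fun_prop)
  refine Continuous.subtype_mk (continuous_matrix fun i j => ?_) _
  fin_cases i
  · exact hu j
  · fin_cases j
    · exact hz.mul (((hv 1).mul (hu 2)).sub ((hv 2).mul (hu 1))).star
    · exact hz.mul (((hv 2).mul (hu 0)).sub ((hv 0).mul (hu 2))).star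
    · exact hz.mul (((hv 0).mul (hu 1)).sub ((hv 1).mul (hu 0))).star
  · exact hv j

/-- The map `(x, y, q, t) ↦ (x, y, q, exp(it))`. -/
noncomputable def expLast (p : ℂ × ℂ × ℂ × ℝ) : ℂ × ℂ × ℂ × Circle :=
  (p.1, p.2.1, p.2.2.1, Circle.exp p.2.2.2)

theorem expLast_surjective : Function.Surjective expLast := by
  rintro ⟨x, y, q, z⟩
  exact ⟨(x, y, q, Complex.arg z), by rw [expLast, Circle.exp_arg]⟩

theorem contDiff_paramU3_expLast (i j : Fin 3) :
    ContDiff ℝ 1 fun p : ℂ × ℂ × ℂ × ℝ => (paramU3 (expLast p)).1 i j := by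
  have hu : ∀ j, ContDiff ℝ 1 fun p : ℂ × ℂ × ℂ × ℝ => firstRow p.1 p.2.1 j := fun j =>
    (contDiff_firstRow j).comp (f := fun p : ℂ × ℂ × ℂ × ℝ => (p.1, p.2.1)) (by fun_prop)
  have hv : ∀ j, ContDiff ℝ 1 fun p : ℂ × ℂ × ℂ × ℝ =>
      lastRow (p.1 * p.2.2.1 - p.2.1) p.2.2.1 j := fun j =>
    (contDiff_lastRow j).comp
      (f := fun p : ℂ × ℂ × ℂ × ℝ => (p.1 * p.2.2.1 - p.2.1, p.2.2.1)) (by fun_prop)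
  have hz : ContDiff ℝ 1 fun p : ℂ × ℂ × ℂ × ℝ => (Circle.exp p.2.2.2 : ℂ) := by
    simp only [Circle.coe_exp]
    exact ((Complex.ofRealCLM.contDiff.comp (by fun_prop)).mul contDiff_const).cexp
  fin_cases i
  · exact hu j
  · fin_cases j
    · exact hz.mul (contDiff_star (((hv 1).mul (hu 2)).sub ((hv 2).mul (hu 1))))
    · exact hz.mul (contDiff_star (((hv 2).mul (hu 0)).sub ((hv 0).mul (hu 2))))
    · exact hz.mul (contDiff_star (((hv 0).mul (hu 1)).sub ((hv 1).mul (hu 0))))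
  · exact hv j

/-! ### Charts and the dimension bound -/

theorem isOpenEmbedding_projH_paramU3_mul (u : U3) :
    Topology.IsOpenEmbedding fun p => projH (mk (paramU3 p * u)) := by
  refine .of_continuous_injective_isOpenMap
    (continuous_projH.comp (continuous_mk.comp (continuous_paramU3.mul continuous_const))) ?_ ?_
  · intro p p' h
    have h1 : projH (mk (paramU3 p)) = projH (mk (paramU3 p')) := by
      simpa [mk_mul] using projH_mul_eq_projH_mul h (mk u)⁻¹
    rw [← coords_paramU3 p, coords_eq_of_projH_eq h1, coords_paramU3]
  · intro V hV
    -- The image of `V` is also the image, under the open map `U₃ → H \ PU₃`, of the matrices whose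
    -- translate by `u⁻¹` has coordinates in `V`.
    have h : (fun p => projH (mk (paramU3 p * u))) '' V = (fun g => projH (mk g)) ''
        ((fun g => g * u⁻¹) ⁻¹' (coordsDomain ∩ U3.coords ⁻¹' V)) := by
      ext x
      constructor
      · rintro ⟨p, hp, rfl⟩
        refine ⟨paramU3 p * u, ?_, rfl⟩
        change paramU3 p * u * u⁻¹ ∈ coordsDomain ∩ U3.coords ⁻¹' V
        rw [mul_inv_cancel_right]
        refine ⟨paramU3_mem_coordsDomain p, ?_⟩
        rwa [Set.mem_preimage, coords_paramU3]
      · rintro ⟨g, ⟨hg, hgV⟩, rfl⟩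
        refine ⟨_, hgV, ?_⟩
        have h := projH_mul_eq_projH_mul (projH_mk_paramU3_coords hg) (mk u)
        rwa [← mk_mul, ← mk_mul, inv_mul_cancel_right] at h
    rw [h]
    exact (isOpenMap_projH.comp isOpenMap_mk) _
      ((continuousOn_coords.isOpen_inter_preimage isOpen_coordsDomain hV).preimage
        (by fun_prop))

theorem exists_projH_paramU3_mul_eq (g : U3) :
    ∃ p, projH (mk (paramU3 p * g)) = projH (mk g) := by
  have h1 : (1 : U3) ∈ coordsDomain := ⟨by simp, by simp⟩
  have h := projH_mul_eq_projH_mul (projH_mk_paramU3_coords h1) (mk g)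
  rw [← mk_mul, ← mk_mul, one_mul] at h
  exact ⟨_, h⟩

theorem isLocalHomeomorph_expLast : IsLocalHomeomorph expLast := by
  refine IsLocalHomeomorph.mk _ fun p => ?_
  obtain ⟨e, he, h⟩ := isLocalHomeomorph_circleExp p.2.2.2
  let r := OpenPartialHomeomorph.refl ℂ
  refine ⟨r.prod (r.prod (r.prod e)), ⟨trivial, trivial, trivial, he⟩, fun q _ => ?_⟩
  rw [expLast, h]
  rfl

/-- By compactness finitely many translated charts suffice, and each contributes a `C¹` image of `ℂ³
× ℝ`, of real dimension `7`. Passing from the circle to `ℝ` puts the domain in a vector space. -/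
theorem dimH_range_invariants : dimH (Set.range HCosets.invariants) ≤ 7 := by
  obtain ⟨s, hs⟩ := isCompact_univ.elim_finite_subcover
    (fun u : U3 => Set.range fun p => projH (mk (paramU3 p * u)))
    (fun u => (isOpenEmbedding_projH_paramU3_mul u).isOpen_range) fun x _ => by
      obtain ⟨g, rfl⟩ := exists_projH_mk_eq x
      exact Set.mem_iUnion.mpr ⟨g, exists_projH_paramU3_mul_eq g⟩
  have hsub : Set.range HCosets.invariants ⊆ ⋃ u ∈ (s : Set U3),
      Set.range fun p => (paramU3 (expLast p) * u).invariants := by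
    rintro _ ⟨x, rfl⟩
    obtain ⟨u, hu, p, rfl⟩ := Set.mem_iUnion₂.mp (hs (Set.mem_univ x))
    obtain ⟨p, rfl⟩ := expLast_surjective p
    exact Set.mem_iUnion₂.mpr ⟨u, hu, p, rfl⟩
  refine (dimH_mono hsub).trans ?_
  rw [dimH_bUnion s.countable_toSet]
  refine iSup₂_le fun u _ => ?_
  have hd : ContDiff ℝ 1 fun p => (paramU3 (expLast p) * u).invariants := by
    have he : ∀ i j, ContDiff ℝ 1 fun p => (paramU3 (expLast p) * u).1 i j := by
      intro i j
      simp only [Submonoid.coe_mul, Matrix.mul_apply]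
      exact .sum fun k _ => (contDiff_paramU3_expLast i k).mul contDiff_const
    exact .prodMk (contDiff_pi.mpr fun i => contDiff_pi.mpr fun j =>
      (contDiff_star (he 0 i)).mul (he 0 j)) (contDiff_pi.mpr fun i => contDiff_pi.mpr fun j =>
        (contDiff_star (he 1 i)).mul (he 2 j))
  refine hd.dimH_range_le.trans ?_
  simp [Complex.finrank_real_complex]

/-! ### Coverings, the manifold, the pullback and the genus -/

instance finite_subgroupK_op : Finite subgroupK.op := Finite.of_equiv _ subgroupK.equivOp

theorem smul_projH (k : subgroupK.op) (g : PU3) : k • projH g = projH (g * k.1.unop) := rfl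

theorem eq_one_of_smul_HCosets_eq (k : subgroupK.op) (x : HCosets) (h : k • x = x) : k = 1 := by
  obtain ⟨g, rfl⟩ : ∃ g, projH g = x := Quotient.exists_rep x
  rw [smul_projH, projH_eq_projH_iff] at h
  exact Subtype.ext (MulOpposite.unop_injective (eq_one_of_conj_mem_subgroupH k.2 h))

instance continuousConstSMul_HCosets : ContinuousConstSMul subgroupK.op HCosets where
  continuous_const_smul k := (isOpenMap_projH.isQuotientMap continuous_projH
    Quotient.mk_surjective).continuous_iff.mpr
      (continuous_projH.comp (continuous_mul_const k.1.unop))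

instance isCancelSMul_HCosets : IsCancelSMul subgroupK.op HCosets :=
  isCancelSMul_iff_eq_one_of_smul_eq.mpr eq_one_of_smul_HCosets_eq

theorem isCoveringMap_projDouble : IsCoveringMap projDouble :=
  (isQuotientCoveringMap_quotientMk_of_properlyDiscontinuousSMul
    (G := subgroupK.op) (E := HCosets)).isCoveringMap

theorem isCoveringMap_projK : IsCoveringMap projK :=
  (subgroupK.isQuotientCoveringMap (Set.finite_coe_iff.mp finite_subgroupK).isDiscrete).isCoveringMap

theorem isTopologicalManifold_doubleCosets : IsTopologicalManifold 7 DoubleCosets := by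
  have : SecondCountableTopology HCosets := ContinuousConstSMul.secondCountableTopology
  refine ⟨inferInstance, ContinuousConstSMul.secondCountableTopology, ?_⟩
  have e : (ℂ × ℂ × ℂ × ℝ) ≃L[ℝ] EuclideanSpace ℝ (Fin 7) := ContinuousLinearEquiv.ofFinrankEq
    (by simp [Complex.finrank_real_complex])
  refine nonempty_chartedSpace_of_isLocalHomeomorph fun x => ?_
  obtain ⟨y, rfl⟩ := Quotient.exists_rep x
  obtain ⟨g, rfl⟩ := exists_projH_mk_eq y
  obtain ⟨p, hp⟩ := exists_projH_paramU3_mul_eq g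
  obtain ⟨p, rfl⟩ := expLast_surjective p
  refine ⟨_, isCoveringMap_projDouble.isLocalHomeomorph.comp
    ((isOpenEmbedding_projH_paramU3_mul g).isLocalHomeomorph.comp
      (isLocalHomeomorph_expLast.comp e.symm.toHomeomorph.isLocalHomeomorph)), e p, ?_⟩
  change projDouble (projH (mk (paramU3 (expLast (e.symm (e p))) * g))) = projDouble _
  rw [e.symm_apply_apply, hp]

theorem continuous_baseMap : Continuous baseMap :=
  .quotient_lift (isCoveringMap_projDouble.continuous.comp continuous_projH) _

theorem projDouble_eq_projDouble_iff {x y : HCosets} :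
    projDouble x = projDouble y ↔ ∃ k : subgroupK.op, k • y = x := Quotient.eq

theorem toPullback_injective : Function.Injective toPullback := by
  intro g g' h
  have hK : projK g = projK g' := congrArg (fun p => p.1.1) h
  have hH : projH g = projH g' := congrArg (fun p => p.1.2) h
  have h1 : g⁻¹ * g' ∈ subgroupK := QuotientGroup.eq.mp hK
  have h2 := eq_one_of_conj_mem_subgroupH (g := g) h1 (by
    rw [projH_eq_projH_iff] at hH
    simpa [mul_assoc] using inv_mem hH)
  exact inv_mul_eq_one.mp h2

theorem toPullback_surjective : Function.Surjective toPullback := by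
  rintro ⟨⟨a, b⟩, h⟩
  obtain ⟨a, rfl⟩ := QuotientGroup.mk_surjective a
  obtain ⟨k, rfl⟩ := projDouble_eq_projDouble_iff.mp (show projDouble b = projDouble (projH a) from
    h.symm)
  refine ⟨a * k.1.unop, Subtype.ext (Prod.ext ?_ rfl)⟩
  refine QuotientGroup.eq.mpr ?_
  have hk : k.1.unop ∈ subgroupK := k.2
  simpa using hk

/-- A continuous bijection from a compact space to a Hausdorff space is a homeomorphism. -/
theorem isHomeomorph_toPullback : IsHomeomorph toPullback := by
  have hK : IsClosed (subgroupK : Set PU3) := (Set.finite_coe_iff.mp finite_subgroupK).isClosed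
  have : T2Space (Function.Pullback baseMap projDouble) :=
    inferInstanceAs (T2Space {p : (PU3 ⧸ subgroupK) × HCosets // baseMap p.1 = projDouble p.2})
  exact isHomeomorph_iff_continuous_bijective.mpr ⟨Continuous.subtype_mk
    (isCoveringMap_projK.continuous.prodMk continuous_projH) _, toPullback_injective,
    toPullback_surjective⟩

theorem hasSectionCover_projK : HasSectionCover projK 8 := by
  have hL : ∀ k : subgroupK.op, ∃ u : U3, mk u = k.1.unop := fun k => mk_surjective _
  choose u hu using hL
  have hmul : ∀ (k : subgroupK.op) (x : PU3), HCosets.invariants (projH (k • x)) =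
      (conjArray (u k)).prodMap (conjArray (u k)) (HCosets.invariants (projH x)) := by
    intro k x
    obtain ⟨g, rfl⟩ := mk_surjective x
    have h : k • mk g = mk (g * u k) := by
      rw [mk_mul, hu]
      rfl
    rw [h]
    exact invariants_mul g (u k)
  have hdim : MeasureTheory.Measure.hausdorffMeasure ((8 : ℕ) : ℝ)
      ((fun x => HCosets.invariants (projH x)) '' Set.univ) = 0 := by
    refine hausdorffMeasure_of_dimH_lt (d := 8) (lt_of_le_of_lt (dimH_mono ?_)
      (dimH_range_invariants.trans_lt (by norm_num)))
    rintro _ ⟨x, -, rfl⟩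
    exact ⟨_, rfl⟩
  obtain ⟨V, hVo, hVd, hVc⟩ :=
    exists_open_disjoint_translates_of_hausdorffMeasure_eq_zero (G := subgroupK.op)
      (HCosets.continuous_invariants.comp continuous_projH)
      (L := fun k => (conjArray (u k)).prodMap (conjArray (u k)))
      (fun k => ⟨_, ((conjArray (u k)).prodMap (conjArray (u k))).toContinuousLinearMap.lipschitz⟩)
      hmul
      (fun k x h => eq_one_of_smul_HCosets_eq k (projH x) (HCosets.invariants_injective h))
      8 Set.univ isClosed_univ (fun _ _ _ => Set.mem_univ _) hdim
  have ho : IsOpenMap projK := QuotientGroup.isOpenMap_coe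
  -- The translates of the `V i` cover `PU₃`, so their images cover `PU₃ / K`; disjointness from
  -- nontrivial translates is injectivity of `projK` on `V i`.
  refine ⟨fun i => projK '' V i, fun i => ho _ (hVo i), Set.eq_univ_of_forall fun b => ?_,
    fun i => exists_continuous_section_image isCoveringMap_projK.continuous ho (hVo i) ?_⟩
  · obtain ⟨x, rfl⟩ := QuotientGroup.mk_surjective b
    obtain ⟨i, k, hk⟩ := hVc x (Set.mem_univ x)
    refine Set.mem_iUnion.mpr ⟨i, _, hk, QuotientGroup.eq.mpr ?_⟩
    have h : (x * k.1.unop)⁻¹ * x = k.1.unop⁻¹ := by group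
    exact h ▸ inv_mem k.2
  · intro x hx y hy h
    have h1 : x⁻¹ * y ∈ subgroupK := QuotientGroup.eq.mp h
    have h2 := hVd i ⟨MulOpposite.op (x⁻¹ * y), h1⟩ x hx (by
      change x * (x⁻¹ * y) ∈ V i
      rwa [mul_inv_cancel_left])
    exact inv_mul_eq_one.mp (congrArg (fun k => k.1.unop) h2)

theorem mainTheorem7 :
    -- `PU₃ → PU₃ / K` is a covering of Schwarz genus at most `8`
    (IsCoveringMap projK ∧ schwarzGenus projK ≤ 8) ∧
    -- `H` meets every conjugate of `K` trivially
    (∀ g : PU3, subgroupH ⊓ subgroupK.map (MulAut.conj g).toMonoidHom = ⊥) ∧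
    -- `K` acts freely on `H \ PU₃`
    (∀ (k : subgroupK.op) (x : HCosets), k • x = x → k = 1) ∧
    -- `H \ PU₃ / K` is a manifold of dimension `7`
    IsTopologicalManifold 7 DoubleCosets ∧
    -- `H \ PU₃ → H \ PU₃ / K` is a covering, and `PU₃ → PU₃ / K` is its pullback
    (IsCoveringMap projDouble ∧ Continuous baseMap ∧ IsHomeomorph toPullback) := by
  refine ⟨⟨isCoveringMap_projK, iInf₂_le 8 hasSectionCover_projK⟩, fun g => ?_,
    eq_one_of_smul_HCosets_eq, isTopologicalManifold_doubleCosets, isCoveringMap_projDouble,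
    continuous_baseMap, isHomeomorph_toPullback⟩
  rw [eq_bot_iff]
  rintro _ ⟨hH, k, hk, rfl⟩
  change g * k * g⁻¹ ∈ subgroupH at hH
  rw [eq_one_of_conj_mem_subgroupH hk hH, map_one]
  exact one_mem _
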